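/- Proposition (the Turaev extended bracket gives invariants of finite type). Knotoid diagrams are taken on the oriented sphere $S^2$, up to isotopy of $S^2$ and the Reidemeister moves away from the two endpoints (leg and head). For a knotoid diagram $K$ choose a shortcut $\alpha$, i.e. an arc from the leg to the head of $K$ which is transversal to $K$ and avoids its crossings, and put $$T_K(A,u)=(-A^3)^{-w(K)}\,u^{-K\cdot\alpha}\sum_{s}A^{\sigma_s}\,u^{k_s\cdot\alpha}\,(-A^2-A^{-2})^{|s|-1}\in\mathbb Z[A^{\pm1},u^{\pm1}],$$ where $w(K)$ is the writhe, $s$ runs over all states of $K$ (choices of an $A$- or $B$-splitting at each crossing), $\sigma_s$ is the number of $A$-splittings minus the number of $B$-splittings, $|s|$ is the number of components of the resulting $1$-manifold, $k_s$ is its segment component, and $K\cdot\alpha$, $k_s\cdot\alpha$ are algebraic intersection numbers with the endpoints not counted, all three arcs being oriented from the leg to the head. Then: 1. $T_K(A,u)$ does not depend on the choice of $\alpha$. 2. Substituting $A=e^x$ yields a power series expansion $T_K(e^x,u)=\sum_{k=0}^{\infty}\sum_{l=-n_1}^{m_1}t_{k,l}(K)\,u^l x^k$ with $t_{k,l}(K)\in\mathbb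 Q$, where $n_1,m_1\ge 0$ depend on $K$ but not on $k$. 3. For all $k\ge 0$ and all $l\in\mathbb Z$, the coefficient $\sum_l t_{k,l}u^l\in\mathbb Q[u^{\pm1}]$ and each individual $t_{k,l}\in\mathbb Q$ are type-$k$ invariants of knotoids (with $t_{k,l}(K)=0$ for $l$ outside $[-n_1,m_1]$). Here a function $v$ of knotoid diagrams with values in an abelian group is a type-$k$ invariant (is of order at most $k$) if it takes equal values on isotopic diagrams and if its extension to singular knotoids vanishes on all singular knotoids with more than $k$ singular crossings. The extension is given by the Vassiliev skein relation $v(\text{singular crossing})=v(\text{positive crossing})-v(\text{negative crossing})$; that is, its value is the sum of the values of $v$ over all ways of replacing every singular crossing by a positive or a negative one, with sign $(-1)^{\#\text{negative replacements}}$. -/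

import Mathlib

open scoped LaurentPolynomial

/-- An oriented plane curve from a leg to a head with `n` transversal double points, recorded by the
order in which the curve passes through its double points.

The two strands through the double point `c` are labelled `true` and `false` so that strand `false`
crosses strand `true` from right to left. A pair `(c, e)` is the passage through `c` along strand `e`.
The edges of the curve are indexed by `Option (Fin n × Bool)`: the edge `none` starts at the leg and
the edge `some p` starts right after the passage `p`. The edge `q` ends at the passage `p` if
`next q = some p`, and at the head if `next q = none`. -/
structure ArcCode where
  n : ℕ
  next : Equiv.Perm (Option (Fin n × Bool))

namespace ArcCode

variable (U : ArcCode)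

abbrev Edge : Type := Option (Fin U.n × Bool)

/-- An edge with a direction of travel: `(q, true)` runs along `q` in the direction of the curve,
`(q, false)` runs against it. -/
abbrev Dart : Type := U.Edge × Bool

variable {U}

def Dart.reverse (d : U.Dart) : U.Dart := (d.1, !d.2)

variable (U)

/-- The last edge of the curve, which ends at the head. -/
def headEdge : U.Edge := U.next.symm none

/-- Walking along the boundary of a region which is kept on the left-hand side: run through the given
dart, turn left at the double point where it ends, and turn back if it ends at the leg or head. -/
def faceStep : U.Dart → U.Dart
  | (q, true) =>
    match U.next q with
    | none => (q, false)
    | some (c, true) => (some (c, false), true)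
    | some (c, false) => (U.next.symm (some (c, true)), false)
  | (none, false) => (none, true)
  | (some (c, true), false) => (U.next.symm (some (c, false)), false)
  | (some (c, false), false) => (some (c, true), true)

/-- The regions of the closed oriented surface that carries the curve with all regions discs:
the boundary cycles of darts. -/
def Region : Type := Quot fun d d' : U.Dart => U.faceStep d = d'

/-- The region on the left-hand side of a dart. -/
def leftRegion (d : U.Dart) : U.Region := Quot.mk _ d

/-- The curve consists of one arc only: every edge is reached from the leg. -/
def IsArc : Prop := ∀ q : U.Edge, ∃ m : ℕ, U.next^[m] none = q

/-- The curve lies on the sphere. The underlying graph is connected with `n + 2` vertices (the double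
points, the leg and the head) and `2 n + 1` edges, so by Euler's formula there are `n + 1` regions. -/
def IsSpherical : Prop := Nat.card U.Region = U.n + 1

/-- The list of darts `l` is the list of edges crossed, each from its left-hand side to its right-hand
side, by a path in the surface from the region `r` to the region `r'`. -/
def IsPath (r : U.Region) (l : List U.Dart) (r' : U.Region) : Prop :=
  match l with
  | [] => r = r'
  | d :: l => r = U.leftRegion d ∧ IsPath (U.leftRegion d.reverse) l r'

/-- A shortcut: a path from the leg to the head which is transversal to the curve and avoids its
double points, recorded by the edges it crosses. -/
structure Shortcut where
  crossed : List U.Dart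
  isPath : U.IsPath (U.leftRegion (none, true)) crossed (U.leftRegion (U.headEdge, true))

theorem leftRegion_faceStep (d : U.Dart) : U.leftRegion (U.faceStep d) = U.leftRegion d :=
  (Quot.sound (r := fun d d' : U.Dart => U.faceStep d = d') rfl).symm

theorem isPath_concat {r r' : U.Region} {l : List U.Dart} {d : U.Dart} (h : U.IsPath r l r')
    (hd : r' = U.leftRegion d) : U.IsPath r (l ++ [d]) (U.leftRegion d.reverse) := by
  induction l generalizing r with
  | nil => exact ⟨Eq.trans h hd, rfl⟩
  | cons a l ih => exact ⟨h.1, ih h.2⟩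

theorem nonempty_shortcut (h : U.IsArc) : Nonempty U.Shortcut := by
  have key : ∀ m : ℕ, ∃ l, U.IsPath (U.leftRegion (none, true)) l
      (U.leftRegion (U.next^[m] none, true)) := by
    intro m
    induction m with
    | zero => exact ⟨[], rfl⟩
    | succ m ih =>
      obtain ⟨l, hl⟩ := ih
      rw [Function.iterate_succ_apply']
      generalize U.next^[m] none = q at hl
      rcases hq : U.next q with _ | ⟨c, e⟩
      · exact ⟨[], rfl⟩
      · refine ⟨l ++ [U.faceStep (q, true)], ?_⟩
        have h1 := U.isPath_concat hl (U.leftRegion_faceStep (q, true)).symm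
        have h2 : U.faceStep (Dart.reverse (U.faceStep (q, true))) = (some (c, e), true) := by
          cases e <;> simp [faceStep, hq, Dart.reverse]
        rwa [← U.leftRegion_faceStep (Dart.reverse _), h2] at h1
  obtain ⟨m, hm⟩ := h U.headEdge
  obtain ⟨l, hl⟩ := key m
  rw [hm] at hl
  exact ⟨⟨l, hl⟩⟩

end ArcCode

/-- A knotoid diagram on the sphere, up to isotopy of the sphere. The crossing `c` is positive if
`positive c = true` and negative otherwise. Since strand `false` crosses strand `true` from right to
left, `(c, true)` is the overpass at a positive crossing and `(c, false)` at a negative one. -/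
structure KnotoidDiagram extends ArcCode where
  isArc : toArcCode.IsArc
  isSpherical : toArcCode.IsSpherical
  positive : Fin n → Bool

namespace KnotoidDiagram

variable (D : KnotoidDiagram)

def overpass (c : Fin D.n) : Fin D.n × Bool := (c, D.positive c)

def underpass (c : Fin D.n) : Fin D.n × Bool := (c, !D.positive c)

/-! ### Isotopy -/

/-- The two diagrams differ by a renumbering of the crossings. -/
def Relabel (D D' : KnotoidDiagram) : Prop :=
  ∃ f : Fin D.n ≃ Fin D'.n, (∀ c, D'.positive (f c) = D.positive c) ∧
    ∀ q, D'.next (Option.map (Prod.map f id) q) = Option.map (Prod.map f id) (D.next q)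

/-- `D'` is obtained from `D` by erasing the crossings in `S`: the passages through the crossings
outside `S` follow each other in the same order, with the same signs. -/
def Erase (D : KnotoidDiagram) (S : Set (Fin D.n)) (D' : KnotoidDiagram) : Prop :=
  ∃ f : Fin D'.n ↪ Fin D.n, Set.range f = Sᶜ ∧ (∀ c, D.positive (f c) = D'.positive c) ∧
    ∀ q, ∃ m : ℕ,
      D.next^[m + 1] (Option.map (Prod.map f id) q) = Option.map (Prod.map f id) (D'.next q) ∧
      ∀ j < m, ∃ c ∈ S, ∃ e, D.next^[j + 1] (Option.map (Prod.map f id) q) = some (c, e)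

/-- Reidemeister I: a crossing whose two passages follow each other is erased. -/
def ReidemeisterI (D D' : KnotoidDiagram) : Prop :=
  ∃ c e, D.next (some (c, e)) = some (c, !e) ∧ D.Erase {c} D'

/-- Reidemeister II: two crossings `c`, `d` of opposite sign are erased, where one strand passes over
`c` and right after that over `d`, and one strand passes in immediate succession under `c` and `d`,
in either order. -/
def ReidemeisterII (D D' : KnotoidDiagram) : Prop :=
  ∃ c d, D.positive c ≠ D.positive d ∧
    D.next (some (D.overpass c)) = some (D.overpass d) ∧
    (D.next (some (D.underpass c)) = some (D.underpass d) ∨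
      D.next (some (D.underpass d)) = some (D.underpass c)) ∧
    D.Erase {c, d} D'

/-- Passages `p` and `p'` follow each other immediately, with `p` first if `a = true` and with `p'`
first otherwise. -/
def Consecutive (a : Bool) (p p' : Fin D.n × Bool) : Prop :=
  if a then D.next (some p) = some p' else D.next (some p') = some p

/-- Reidemeister III, for a top, a middle and a bottom strand, which form a triangle with corners `x`
(top over middle), `y` (top over bottom) and `z` (middle over bottom). The strands are directed from
`x` to `y`, from `x` to `z` and from `y` to `z` if `a`, `b`, `c` are `true`, respectively, and
oppositely otherwise. The signs of `x`, `y`, `z` are the products of the directions of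
the two strands involved with the orientation `± 1` of the triangle `x y z`; this is the condition on
the signs, and it holds precisely if the three edges bound a triangular region. The move interchanges
the two passages on each of the three strands. -/
def ReidemeisterIII (D D' : KnotoidDiagram) : Prop :=
  ∃ x y z, x ≠ y ∧ x ≠ z ∧ y ≠ z ∧ ∃ a b c : Bool,
    D.Consecutive a (D.overpass x) (D.overpass y) ∧
    D.Consecutive b (D.underpass x) (D.overpass z) ∧
    D.Consecutive c (D.underpass y) (D.underpass z) ∧
    (D.positive x = D.positive y ↔ b = c) ∧ (D.positive x = D.positive z ↔ a = c) ∧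
    ∃ f : Fin D.n ≃ Fin D'.n, (∀ v, D'.positive (f v) = D.positive v) ∧
      ∃ σ : Equiv.Perm D.Edge,
        σ = Equiv.swap (some (D.overpass x)) (some (D.overpass y)) *
            Equiv.swap (some (D.underpass x)) (some (D.overpass z)) *
            Equiv.swap (some (D.underpass y)) (some (D.underpass z)) ∧
        ∀ q, D'.next (Option.map (Prod.map f id) (σ q)) =
          Option.map (Prod.map f id) (σ (D.next q))

def Move (D D' : KnotoidDiagram) : Prop :=
  D.Relabel D' ∨ D.ReidemeisterI D' ∨ D.ReidemeisterII D' ∨ D.ReidemeisterIII D'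

/-- Two knotoid diagrams on the sphere are isotopic, that is, they represent the same knotoid. -/
def Isotopic : KnotoidDiagram → KnotoidDiagram → Prop := Relation.EqvGen Move

/-! ### States and the extended bracket -/

/-- A state: `s c = true` for the `A`-splitting at `c` and `s c = false` for the `B`-splitting. -/
abbrev State : Type := Fin D.n → Bool

variable {D}

/-- The `A`-splitting joins the two regions swept when the overpass is turned counterclockwise. It
respects the orientation of the curve at a positive crossing, while the `B`-splitting does so at a
negative crossing. -/
def State.Oriented (s : D.State) (c : Fin D.n) : Prop := s c = D.positive c

instance (s : D.State) (c : Fin D.n) : Decidable (s.Oriented c) :=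
  inferInstanceAs (Decidable (s c = D.positive c))

/-- The dart that follows a given one on the curve obtained by splitting all crossings according to
the state; `none` if the given dart ends at the leg or the head. -/
def State.step (s : D.State) : D.Dart → Option D.Dart
  | (q, true) =>
    match D.next q with
    | none => none
    | some (c, e) =>
      if s.Oriented c then some (some (c, !e), true)
      else some (D.next.symm (some (c, !e)), false)
  | (none, false) => none
  | (some (c, e), false) =>
      if s.Oriented c then some (D.next.symm (some (c, !e)), false)
      else some (some (c, !e), true)

/-- The components of the 1-manifold obtained by splitting all crossings. -/
def State.Component (s : D.State) : Type :=
  Quot fun q q' : D.Edge => ∃ e e' : Bool, s.step (q, e) = some (q', e')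

/-- The dart `d` lies on the segment component, oriented from the leg to the head. -/
def State.OnSegment (s : D.State) (d : D.Dart) : Prop :=
  Relation.ReflTransGen (fun d d' : D.Dart => s.step d = some d') (none, true) d

open Classical in
/-- How the segment component, oriented from the leg to the head, runs through the edge `q`:
`1` in the direction of the diagram, `-1` in the opposite direction, `0` not at all. -/
noncomputable def State.segment (s : D.State) (q : D.Edge) : ℤ :=
  (if s.OnSegment (q, true) then 1 else 0) - (if s.OnSegment (q, false) then 1 else 0)

/-- The sum of the values `± 1` of the splittings of the state. -/
def State.exponent (s : D.State) : ℤ := ∑ c, if s c then 1 else -1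

/-- The algebraic intersection number with the shortcut `α` of the 1-chain in which the edge `q` has
coefficient `w q`. The sign of an intersection is `1` if the direction of the edge followed by the
direction of `α` is a positive frame, i.e. if `α` crosses the edge from right to left. -/
def intersection (w : D.Edge → ℤ) (α : D.Shortcut) : ℤ :=
  (α.crossed.map fun d => w d.1 * if d.2 then -1 else 1).sum

variable (D)

def writhe : ℤ := ∑ c, if D.positive c then 1 else -1

end KnotoidDiagram

/-- Laurent polynomials in `A` whose coefficients are integral Laurent polynomials in `u`. -/
abbrev BracketRing : Type := LaurentPolynomial (LaurentPolynomial ℤ)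

/-- The invertible element `A ^ 3`. -/
noncomputable def cubeUnit : BracketRingˣ where
  val := LaurentPolynomial.T 3
  inv := LaurentPolynomial.T (-3)
  val_inv := by rw [← LaurentPolynomial.T_add]; simp
  inv_val := by rw [← LaurentPolynomial.T_add]; simp

/-- The power `u ^ m`. -/
noncomputable def uPow (m : ℤ) : BracketRing := LaurentPolynomial.C (LaurentPolynomial.T m)

/-- The invertible power series `e ^ x`, over the ring of rational Laurent polynomials in `u`. -/
noncomputable def expUnit : (PowerSeries (LaurentPolynomial ℚ))ˣ where
  val := PowerSeries.exp _
  inv := PowerSeries.evalNegHom (PowerSeries.exp _)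
  val_inv := PowerSeries.exp_mul_exp_neg_eq_one
  inv_val := by
    rw [mul_comm]
    exact PowerSeries.exp_mul_exp_neg_eq_one

/-- The substitution `A = e ^ x`, which fixes `u`. -/
noncomputable def substExp : BracketRing →+* PowerSeries (LaurentPolynomial ℚ) :=
  LaurentPolynomial.eval₂
    (PowerSeries.C.comp (AddMonoidAlgebra.mapRingHom ℤ (Int.castRingHom ℚ))) expUnit

namespace KnotoidDiagram

variable (D : KnotoidDiagram)

/-- The extended bracket computed with the shortcut `α`:
`(-A³)^(-w(K)) u^(-K·α) ∑ₛ A^(σₛ) u^(kₛ·α) (-A² - A⁻²)^(|s| - 1)`. -/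
noncomputable def extendedBracketAlong (α : D.Shortcut) : BracketRing :=
  (((-cubeUnit) ^ (-D.writhe) : BracketRingˣ) : BracketRing) *
    uPow (-intersection (fun _ => 1) α) *
    ∑ s : D.State, LaurentPolynomial.T s.exponent * uPow (intersection s.segment α) *
      (-LaurentPolynomial.T 2 - LaurentPolynomial.T (-2)) ^ (Nat.card s.Component - 1)

/-- The extended bracket polynomial of Turaev, computed with a shortcut of our choice. -/
noncomputable def extendedBracket : BracketRing :=
  D.extendedBracketAlong (D.toArcCode.nonempty_shortcut D.isArc).some

/-- The extended bracket polynomial after the substitution `A = e ^ x`, as a power series in `x`. -/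
noncomputable def extendedBracketSeries : PowerSeries (LaurentPolynomial ℚ) :=
  substExp D.extendedBracket

/-- The coefficient `t_{k,l}` of `u ^ l x ^ k`. -/
noncomputable def bracketCoeff (k : ℕ) (l : ℤ) : ℚ :=
  (PowerSeries.coeff k D.extendedBracketSeries).coeff l

end KnotoidDiagram

/-! ### Singular knotoids and invariants of finite type -/

/-- A singular knotoid diagram on the sphere: each double point `c` is a positive crossing
(`kind c = some true`), a negative crossing (`kind c = some false`) or a singular crossing
(`kind c = none`). -/
structure SingularKnotoidDiagram extends ArcCode where
  isArc : toArcCode.IsArc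
  isSpherical : toArcCode.IsSpherical
  kind : Fin n → Option Bool

namespace SingularKnotoidDiagram

variable (S : SingularKnotoidDiagram)

abbrev SingularCrossing : Type := {c : Fin S.n // S.kind c = none}

/-- The diagram in which the singular crossings are replaced by positive crossings where `ε` is
`true` and by negative ones where `ε` is `false`. -/
def resolve (ε : S.SingularCrossing → Bool) : KnotoidDiagram where
  toArcCode := S.toArcCode
  isArc := S.isArc
  isSpherical := S.isSpherical
  positive c :=
    match h : S.kind c with
    | some b => b
    | none => ε ⟨c, h⟩

/-- The value at a singular knotoid diagram of the extension of `v` by the Vassiliev skein relation: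
the sum of the values at all resolutions, with a sign for each negative resolution. -/
def extend {G : Type*} [AddCommGroup G] (v : KnotoidDiagram → G) : G :=
  ∑ ε : S.SingularCrossing → Bool, (∏ c, if ε c then (1 : ℤ) else -1) • v (S.resolve ε)

end SingularKnotoidDiagram

/-- `v` is an invariant of spherical knotoids. -/
def IsKnotoidInvariant {G : Type*} (v : KnotoidDiagram → G) : Prop :=
  ∀ D D' : KnotoidDiagram, D.Isotopic D' → v D = v D'

/-- `v` is a knotoid invariant of finite type `k` (of order at most `k`): its extension vanishes on
all singular knotoids with more than `k` singular crossings. -/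
def IsTypeInvariant {G : Type*} [AddCommGroup G] (k : ℕ) (v : KnotoidDiagram → G) : Prop :=
  IsKnotoidInvariant v ∧
    ∀ S : SingularKnotoidDiagram, k < Fintype.card S.SingularCrossing → S.extend v = 0

/-! Multiplying the bracket by δ = -A² - A⁻² (`loopValue`) turns the exponent |s| - 1 into |s| and
loses nothing, the ring being a domain. A state is recorded by which of its splittings respect the
orientation, instead of by the letters A and B. Then the resulting 1-manifold depends on the
underlying curve only, and the signs of the crossings enter through the factors `splitWeight` alone,
which also absorb the writhe.

The shortcut drops out as follows. The chain k_s - K is a cycle, so on the sphere it consists of the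
jumps of a function on the regions (`range_jump`, a dimension count based on Euler's formula). Its
intersection number with any shortcut is the difference of that function between head and leg.
Walking there along the left side of K expresses this difference as a sum of local terms at the
crossings (`Shortcut.sum_cycle`). Hence δ T_K equals `stateSum`, where no shortcut occurs.

For a Reidemeister move, the sum is first taken over the splittings of the crossings involved. A
strand running along an inner edge can be cut short at the price of a factor δ (`eval_contract`), so
multiples by powers of δ reduce to a few pairings of the outer ends, whose coefficients are
compared: `sum_monogon`, `eval_bigon`, `triangleSum_reflect`. Kirchhoff's law expresses the exponent
of u contributed by these crossings by the flow at outer ends. Erased crossings are then removed by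
a retraction of edges (`exists_retraction`).

For the expansion, e^(nx) has rational coefficients, so the powers of u are those of T_K. For finite
type, each term of the alternating sum over resolutions contains, for every singular crossing, the
difference of the positive and the negative weight of one and the same splitting
(`loopValue_mul_extend`). Both weights are -1 at A = 1, so each difference is divisible by x, while
δ becomes a unit with constant term -2. Thus x^m divides the extension to m singular crossings. -/

/-! ### Wirings: pairings of the ends of edges -/

namespace Wiring

/-- The end `(q, b)` of the edge `q` and the opposite end. -/
def opp {E : Type} (d : E × Bool) : E × Bool := (d.1, !d.2)

@[simp] theorem opp_opp {E : Type} (d : E × Bool) : opp (opp d) = d := by simp [opp]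

@[simp] theorem opp_fst {E : Type} (d : E × Bool) : (opp d).1 = d.1 := rfl

theorem opp_ne {E : Type} (d : E × Bool) : opp d ≠ d := by
  intro h
  have := congrArg Prod.snd h
  simp [opp] at this

theorem opp_injective {E : Type} : Function.Injective (opp : E × Bool → E × Bool) :=
  Function.LeftInverse.injective opp_opp

theorem eq_or_eq_opp {E : Type} {d d' : E × Bool} (h : d.1 = d'.1) : d = d' ∨ d = opp d' := by
  obtain ⟨q, b⟩ := d
  obtain ⟨q', b'⟩ := d'
  obtain rfl : q = q' := h
  cases b <;> cases b' <;> simp [opp]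

variable {E : Type} {R : Type*} [CommRing R]

/-- The pairing `P` joins an end of `q` to an end of `q'`. -/
def Joined (P : E × Bool → E × Bool → Prop) (q q' : E) : Prop := ∃ b b', P (q, b) (q', b')

theorem Joined.of {P : E × Bool → E × Bool → Prop} {d d' : E × Bool} (h : P d d') :
    Joined P d.1 d'.1 := ⟨d.2, d'.2, h⟩

def Comp (P : E × Bool → E × Bool → Prop) : Type := Quot (Joined P)

def Comp.mk (P : E × Bool → E × Bool → Prop) (q : E) : Comp P := Quot.mk _ q

theorem Comp.sound {P : E × Bool → E × Bool → Prop} {d d' : E × Bool} (h : P d d') :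
    Comp.mk P d.1 = Comp.mk P d'.1 := Quot.sound (Joined.of h)

theorem Comp.ind {P : E × Bool → E × Bool → Prop} {p : Comp P → Prop}
    (h : ∀ q, p (Comp.mk P q)) (x : Comp P) : p x := Quot.ind h x

/-- The number of components of the 1-manifold obtained from the edges by joining ends. -/
noncomputable def comps (P : E × Bool → E × Bool → Prop) : ℕ := Nat.card (Comp P)

/-- `W d` is the flow along the component of `r`, directed away from `r`, in the direction from the
end `d` of an edge to the opposite end. -/
structure IsFlow (P : E × Bool → E × Bool → Prop) (r : E) (W : E × Bool → ℤ) : Prop where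
  opp : ∀ d, W (opp d) = -W d
  pair : ∀ d d', P d d' → W d = -W d'
  root : W (r, true) = 1
  support : ∀ d, W d ≠ 0 → Comp.mk P d.1 = Comp.mk P r

/-- Joined ends and opposite ends carry opposite values, so one value determines the flow along a
whole component. The root fixes its own component, and `support` makes the flow vanish on the
others. -/
theorem IsFlow.unique {P : E × Bool → E × Bool → Prop} {r : E} {W W' : E × Bool → ℤ}
    (h : IsFlow P r W) (h' : IsFlow P r W') : W = W' := by
  have edge : ∀ {d d' : E × Bool}, d.1 = d'.1 → W d = W' d → W d' = W' d' := by
    intro d d' hd e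
    rcases eq_or_eq_opp hd with rfl | rfl
    · exact e
    · rw [h.opp, h'.opp] at e
      omega
  have key : ∀ q q', Relation.EqvGen (Joined P) q q' →
      (W (q, true) = W' (q, true) ↔ W (q', true) = W' (q', true)) := by
    intro q q' hq
    induction hq with
    | rel q q' hr =>
      obtain ⟨b, b', hp⟩ := hr
      have e := h.pair _ _ hp
      have e' := h'.pair _ _ hp
      constructor <;> intro hh
      · have h1 : W (q, b) = W' (q, b) := edge (d := (q, true)) rfl hh
        exact edge (d := (q', b')) rfl (by omega)
      · have h1 : W (q', b') = W' (q', b') := edge (d := (q', true)) rfl hh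
        exact edge (d := (q, b)) rfl (by omega)
    | refl => exact Iff.rfl
    | symm _ _ _ ih => exact ih.symm
    | trans _ _ _ _ _ ih ih' => exact ih.trans ih'
  funext d
  by_cases hd : Comp.mk P d.1 = Comp.mk P r
  · have := (key _ _ (Quot.eqvGen_exact hd)).2 (by rw [h.root, h'.root])
    exact edge (d := (d.1, true)) rfl this
  · rw [not_not.1 fun hn => hd (h.support d hn), not_not.1 fun hn => hd (h'.support d hn)]

open Classical in
/-- `U W * δ ^ k`, where `W` is the flow along the component of `r` and `k` is the number of
components. -/
noncomputable def eval (r : E) (δ : R) (U : (E × Bool → ℤ) → R) (P : E × Bool → E × Bool → Prop) :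
    R :=
  -- Without a flow the value is 0. `eval_congr_of_imp` and `eval_contract` transfer flows in both
  -- directions and therefore need no existence hypothesis.
  if h : ∃ W, IsFlow P r W then U h.choose * δ ^ comps P else 0

theorem eval_eq {P : E × Bool → E × Bool → Prop} {r : E} {W : E × Bool → ℤ} (h : IsFlow P r W)
    (δ : R) (U : (E × Bool → ℤ) → R) : eval r δ U P = U W * δ ^ comps P := by
  have hex : ∃ W, IsFlow P r W := ⟨W, h⟩
  rw [eval, dif_pos hex, hex.choose_spec.unique h]

theorem eval_congr_weight {P : E × Bool → E × Bool → Prop} {r : E} {δ : R}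
    {U U' : (E × Bool → ℤ) → R} (h : ∀ W, IsFlow P r W → U W = U' W) :
    eval r δ U P = eval r δ U' P := by
  by_cases hex : ∃ W, IsFlow P r W
  · obtain ⟨W, hW⟩ := hex
    rw [eval_eq hW, eval_eq hW, h W hW]
  · rw [eval, eval, dif_neg hex, dif_neg hex]

/-- Two pairings with the same pairs of joined edges and the same flows. -/
theorem eval_congr_of_imp {P P' : E × Bool → E × Bool → Prop} (r : E) (δ : R)
    (U : (E × Bool → ℤ) → R)
    (h : ∀ d d', P d d' → P' d d' ∨ P' d' d ∨ d' = opp d)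
    (h' : ∀ d d', P' d d' → P d d' ∨ P d' d ∨ d' = opp d) :
    eval r δ U P = eval r δ U P' := by
  have descend : ∀ {P P' : E × Bool → E × Bool → Prop},
      (∀ d d', P d d' → P' d d' ∨ P' d' d ∨ d' = opp d) → ∀ q q', Joined P q q' →
        Comp.mk P' q = Comp.mk P' q' := by
    intro P P' h q q' hr
    obtain ⟨b, b', hp⟩ := hr
    rcases h _ _ hp with hh | hh | hh
    · exact Comp.sound hh
    · exact (Comp.sound hh).symm
    · rw [show q' = q from congrArg Prod.fst hh]
  let e : Comp P ≃ Comp P' :=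
    { toFun := Quot.lift (Comp.mk P') (descend h)
      invFun := Quot.lift (Comp.mk P) (descend h')
      left_inv := by rintro ⟨q⟩; rfl
      right_inv := by rintro ⟨q⟩; rfl }
  have flow : ∀ {P P' : E × Bool → E × Bool → Prop},
      (∀ d d', P d d' → P' d d' ∨ P' d' d ∨ d' = opp d) →
      (∀ d d', P' d d' → P d d' ∨ P d' d ∨ d' = opp d) → ∀ W, IsFlow P r W → IsFlow P' r W := by
    intro P P' h h' W hW
    refine ⟨hW.opp, ?_, hW.root, ?_⟩
    · intro d d' hp
      rcases h' _ _ hp with hh | hh | rfl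
      · exact hW.pair _ _ hh
      · rw [hW.pair _ _ hh, neg_neg]
      -- A pair of opposite ends closes its edge up to a circle: it joins no new edges, and the
      -- condition it puts on the flow is antisymmetry.
      · rw [hW.opp, neg_neg]
    · intro d hd
      exact congrArg (Quot.lift (Comp.mk P') (descend h)) (hW.support d hd)
  have hc : comps P = comps P' := Nat.card_congr e
  by_cases hex : ∃ W, IsFlow P r W
  · obtain ⟨W, hW⟩ := hex
    rw [eval_eq hW, eval_eq (flow h h' W hW), hc]
  · have hex' : ¬ ∃ W, IsFlow P' r W := fun ⟨W, hW⟩ => hex ⟨W, flow h' h W hW⟩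
    rw [eval, eval, dif_neg hex, dif_neg hex']

/-- The pairing `P₀` together with the pairs in the list `L`. -/
def add (P₀ : E × Bool → E × Bool → Prop) (L : List ((E × Bool) × (E × Bool))) :
    E × Bool → E × Bool → Prop :=
  fun d d' => P₀ d d' ∨ (d, d') ∈ L

/-- Two lists with the same unordered pairs, apart from the pairs of opposite ends. -/
def SamePairs (L L' : List ((E × Bool) × (E × Bool))) : Prop :=
  (∀ p ∈ L, p ∈ L' ∨ p.swap ∈ L' ∨ p.2 = opp p.1) ∧ ∀ p ∈ L', p ∈ L ∨ p.swap ∈ L ∨ p.2 = opp p.1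

theorem eval_add_congr (r : E) (δ : R) (U : (E × Bool → ℤ) → R)
    (P₀ : E × Bool → E × Bool → Prop) {L L' : List ((E × Bool) × (E × Bool))}
    (h : SamePairs L L') : eval r δ U (add P₀ L) = eval r δ U (add P₀ L') := by
  have aux : ∀ {L L' : List ((E × Bool) × (E × Bool))},
      (∀ p ∈ L, p ∈ L' ∨ p.swap ∈ L' ∨ p.2 = opp p.1) → ∀ d d', add P₀ L d d' →
        add P₀ L' d d' ∨ add P₀ L' d' d ∨ d' = opp d := by
    intro L L' h d d' hd
    rcases hd with hd | hd
    · exact .inl (.inl hd)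
    · rcases h _ hd with hh | hh | hh
      · exact .inl (.inr hh)
      · exact .inr (.inl (.inr hh))
      · exact .inr (.inr hh)
  exact eval_congr_of_imp r δ U (aux h.1) (aux h.2)

/-- No end of the edge of `b` is paired. -/
def Avoids (P₀ : E × Bool → E × Bool → Prop) (b : E × Bool) : Prop :=
  ∀ d d', P₀ d d' → d.1 ≠ b.1 ∧ d'.1 ≠ b.1

/-- A passage along an edge `b` may be replaced by a shortcut, which leaves `b` as an additional
component. -/
theorem eval_contract [Finite E] (r : E) (δ : R) (U : (E × Bool → ℤ) → R)
    (P₀ : E × Bool → E × Bool → Prop) (L : List ((E × Bool) × (E × Bool))) {a b c : E × Bool}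
    (hr : b.1 ≠ r) (ha : a.1 ≠ b.1) (hc : c.1 ≠ b.1) (h₀ : Avoids P₀ b)
    (hL : ∀ p ∈ L, p.1.1 ≠ b.1 ∧ p.2.1 ≠ b.1)
    (hU : ∀ W W', (∀ d, d.1 ≠ b.1 → W d = W' d) → U W = U W') :
    eval r δ U (add P₀ ((a, c) :: L)) = δ * eval r δ U (add P₀ ((a, b) :: (opp b, c) :: L)) := by
  classical
  set P₁ := add P₀ ((a, b) :: (opp b, c) :: L) with hP₁
  set P₂ := add P₀ ((a, c) :: L) with hP₂
  have hab : Comp.mk P₁ a.1 = Comp.mk P₁ b.1 := Comp.sound (.inr (by simp))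
  have hbc : Comp.mk P₁ b.1 = Comp.mk P₁ c.1 :=
    Comp.sound (P := P₁) (d := opp b) (d' := c) (.inr (by simp))
  have hac : Comp.mk P₂ a.1 = Comp.mk P₂ c.1 := Comp.sound (.inr (by simp))
  have old : ∀ {d d'}, (P₀ d d' ∨ (d, d') ∈ L) → d.1 ≠ b.1 ∧ d'.1 ≠ b.1 := by
    rintro d d' (h | h)
    · exact h₀ _ _ h
    · exact hL _ h
  have cases₁ : ∀ {d d'}, P₁ d d' → (P₀ d d' ∨ (d, d') ∈ L) ∨ (d = a ∧ d' = b) ∨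
      (d = opp b ∧ d' = c) := by
    intro d d' h
    rcases h with h | h
    · exact .inl (.inl h)
    · simp only [List.mem_cons, Prod.mk.injEq] at h
      tauto
  have cases₂ : ∀ {d d'}, P₂ d d' → (P₀ d d' ∨ (d, d') ∈ L) ∨ (d = a ∧ d' = c) := by
    intro d d' h
    rcases h with h | h
    · exact .inl (.inl h)
    · simp only [List.mem_cons, Prod.mk.injEq] at h
      tauto
  have mem₁ : ∀ {d d'}, (P₀ d d' ∨ (d, d') ∈ L) → P₁ d d' := by
    rintro d d' (h | h)
    · exact .inl h
    · exact .inr (by simp [h])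
  have mem₂ : ∀ {d d'}, (P₀ d d' ∨ (d, d') ∈ L) → P₂ d d' := by
    rintro d d' (h | h)
    · exact .inl h
    · exact .inr (by simp [h])
  have ne₂ : ∀ {d d'}, P₂ d d' → d.1 ≠ b.1 ∧ d'.1 ≠ b.1 := by
    intro d d' h
    rcases cases₂ h with h | ⟨rfl, rfl⟩
    · exact old h
    · exact ⟨ha, hc⟩
  let f : E → Option (Comp P₁) := fun q => if q = b.1 then none else some (Comp.mk P₁ q)
  let g : E → Comp P₂ := fun q => if q = b.1 then Comp.mk P₂ a.1 else Comp.mk P₂ q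
  have hf : ∀ q q', Joined P₂ q q' → f q = f q' := by
    rintro q q' ⟨e, e', h⟩
    have hn := ne₂ h
    simp only [f]
    rw [if_neg hn.1, if_neg hn.2]
    rcases cases₂ h with h | ⟨h1, h2⟩
    · exact congrArg some (Comp.sound (mem₁ h))
    · rw [show q = a.1 by rw [← h1], show q' = c.1 by rw [← h2], hab, hbc]
  have hg : ∀ q q', Joined P₁ q q' → g q = g q' := by
    rintro q q' ⟨e, e', h⟩
    simp only [g]
    rcases cases₁ h with h | ⟨h1, h2⟩ | ⟨h1, h2⟩
    · have hn := old h
      rw [if_neg hn.1, if_neg hn.2]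
      exact Comp.sound (mem₂ h)
    · rw [show q = a.1 by rw [← h1], show q' = b.1 by rw [← h2], if_neg ha, if_pos rfl]
    · rw [show q = b.1 by rw [← opp_fst b, ← h1], show q' = c.1 by rw [← h2], if_neg hc,
        if_pos rfl, hac]
  -- In `P₂` both ends of `b` are free, so the edge of `b` is a component by itself, sent to `none`.
  -- The remaining components correspond to those of `P₁`.
  let e : Comp P₂ ≃ Option (Comp P₁) :=
    { toFun := Quot.lift f hf
      invFun := fun o => o.elim (Comp.mk P₂ b.1) (Quot.lift g hg)
      left_inv := by
        refine Comp.ind fun q => ?_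
        change Option.elim (f q) _ _ = _
        by_cases hq : q = b.1
        · rw [show f q = none from if_pos hq, hq]
          rfl
        · simp only [f, if_neg hq, Option.elim]
          exact if_neg hq
      right_inv := by
        rintro (_ | x)
        · exact if_pos rfl
        · revert x
          refine Comp.ind fun q => ?_
          change Quot.lift f hf (g q) = _
          by_cases hq : q = b.1
          · simp only [g, if_pos hq]
            exact (if_neg ha).trans (by rw [hab, hq])
          · simp only [g, if_neg hq]
            exact if_neg hq }
  have : Finite (Comp P₁) := Quot.finite _
  have hcard : comps P₂ = comps P₁ + 1 := by
    rw [comps, Nat.card_congr e, Finite.card_option, comps]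
  have flow₂ : ∀ W, IsFlow P₁ r W → IsFlow P₂ r (fun d => if d.1 = b.1 then 0 else W d) := by
    intro W hW
    refine ⟨?_, ?_, ?_, ?_⟩
    · intro d
      by_cases hd : d.1 = b.1 <;> simp [hd, hW.opp]
    · intro d d' h
      have hn := ne₂ h
      simp only [hn.1, hn.2, if_false]
      rcases cases₂ h with h | ⟨rfl, rfl⟩
      · exact hW.pair _ _ (mem₁ h)
      · have h1 := hW.pair d b (.inr (by simp))
        have h2 := hW.pair (opp b) d' (.inr (by simp))
        rw [hW.opp] at h2
        omega
    · simp [hr.symm, hW.root]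
    · intro d hd
      have hd' : d.1 ≠ b.1 := fun h => hd (if_pos h)
      have := congrArg (Quot.lift g hg) (hW.support d (by simpa [hd'] using hd))
      change g _ = g _ at this
      simpa [g, hd', hr.symm] using this
  -- Contracting forgets the flow on the edge of `b`; conversely, the pair `(a, b)` forces the value
  -- `-W a` there.
  have flow₁ : ∀ W, IsFlow P₂ r W → IsFlow P₁ r
      (fun d => if d = b then -W a else if d = opp b then W a else W d) := by
    intro W hW
    have off : ∀ {d : E × Bool}, d.1 ≠ b.1 → d ≠ b ∧ d ≠ opp b := fun h =>
      ⟨fun hh => h (by rw [hh]), fun hh => h (by rw [hh, opp_fst])⟩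
    refine ⟨?_, ?_, ?_, ?_⟩
    · intro d
      by_cases hd : d.1 = b.1
      · rcases eq_or_eq_opp hd with rfl | rfl
        · simp [opp_ne]
        · simp [opp_ne]
      · have hd' : (opp d).1 ≠ b.1 := hd
        simp only [(off hd).1, (off hd).2, (off hd').1, (off hd').2, if_false, hW.opp]
    · intro d d' h
      have hWac := hW.pair a c (.inr (by simp))
      rcases cases₁ h with h | ⟨h1, h2⟩ | ⟨h1, h2⟩
      · have hn := old h
        simp only [(off hn.1).1, (off hn.1).2, (off hn.2).1, (off hn.2).2, if_false]
        exact hW.pair _ _ (mem₂ h)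
      · subst h1 h2
        simp [(off ha).1, (off ha).2]
      · subst h1 h2
        simp [(off hc).1, (off hc).2, opp_ne, hWac]
    · have : ((r, true) : E × Bool).1 ≠ b.1 := hr.symm
      simp only [(off this).1, (off this).2, if_false, hW.root]
    · intro d hd
      have key : ∀ x : E × Bool, x.1 ≠ b.1 → W x ≠ 0 → Comp.mk P₁ x.1 = Comp.mk P₁ r := by
        intro x hx hx'
        have := congrArg (Quot.lift f hf) (hW.support x hx')
        change f _ = f _ at this
        simpa [f, hx, hr.symm] using this
      by_cases hdb : d.1 = b.1
      · rw [hdb, ← hab]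
        apply key a ha
        rcases eq_or_eq_opp hdb with rfl | rfl
        · simpa using hd
        · simpa [opp_ne] using hd
      · exact key d hdb (by simpa [(off hdb).1, (off hdb).2] using hd)
  by_cases hex : ∃ W, IsFlow P₁ r W
  · obtain ⟨W, hW⟩ := hex
    rw [eval_eq hW, eval_eq (flow₂ W hW), hcard, hU _ W (fun d hd => if_neg hd)]
    ring
  · have hex' : ¬ ∃ W, IsFlow P₂ r W := fun ⟨W, hW⟩ => hex ⟨_, flow₁ W hW⟩
    rw [eval, eval, dif_neg hex, dif_neg hex', mul_zero]

/-- A retraction of the edges which is compatible with the pairings does not change the value. -/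
theorem eval_retract {E' : Type} {P : E × Bool → E × Bool → Prop}
    {P' : E' × Bool → E' × Bool → Prop} {r : E} {r' : E'} (δ : R) (U : (E × Bool → ℤ) → R)
    (U' : (E' × Bool → ℤ) → R) (χ : E → E') (φ : E' → E) (hχr : χ r = r')
    (hP : ∀ d d', P d d' → P' (χ d.1, d.2) (χ d'.1, d'.2) ∨ P' (χ d'.1, d'.2) (χ d.1, d.2) ∨
      (χ d.1, d.2) = opp (χ d'.1, d'.2))
    (hP' : ∀ d d', P' d d' → Comp.mk P (φ d.1) = Comp.mk P (φ d'.1))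
    (hφχ : ∀ q, Comp.mk P (φ (χ q)) = Comp.mk P q) (hχφ : ∀ q, χ (φ q) = q)
    {W' : E' × Bool → ℤ} (hW' : IsFlow P' r' W')
    (hU : ∀ W, IsFlow P r W → (∀ d, W d = W' (χ d.1, d.2)) → U W = U' W') :
    eval r δ U P = eval r' δ U' P' := by
  have hf : ∀ q q', Joined P q q' → Comp.mk P' (χ q) = Comp.mk P' (χ q') := by
    rintro q q' ⟨b, b', h⟩
    rcases hP _ _ h with h | h | h
    · exact Comp.sound h
    · exact (Comp.sound h).symm
    · exact congrArg (fun d => Comp.mk P' d.1) h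
  have hg : ∀ q q', Joined P' q q' → Comp.mk P (φ q) = Comp.mk P (φ q') := by
    rintro q q' ⟨b, b', h⟩
    exact hP' _ _ h
  let e : Comp P ≃ Comp P' :=
    { toFun := Quot.lift (fun q => Comp.mk P' (χ q)) hf
      invFun := Quot.lift (fun q => Comp.mk P (φ q)) hg
      left_inv := Comp.ind fun q => hφχ q
      right_inv := Comp.ind fun q => congrArg (Comp.mk P') (hχφ q) }
  have hW : IsFlow P r (fun d => W' (χ d.1, d.2)) := by
    refine ⟨?_, ?_, ?_, ?_⟩
    · intro d
      exact hW'.opp (χ d.1, d.2)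
    · intro d d' h
      rcases hP _ _ h with h | h | h
      · exact hW'.pair _ _ h
      · have := hW'.pair _ _ h
        change W' (χ d.1, d.2) = -W' (χ d'.1, d'.2)
        omega
      · simp only [h]
        exact hW'.opp (χ d'.1, d'.2)
    · simp only [hχr]
      exact hW'.root
    · intro d hd
      have := congrArg (Quot.lift (fun q => Comp.mk P (φ q)) hg) (hW'.support _ hd)
      change Comp.mk P (φ (χ d.1)) = Comp.mk P (φ r') at this
      rw [← hφχ d.1, this, ← hχr, hφχ]
  rw [eval_eq hW, eval_eq hW', hU _ hW fun _ => rfl, comps, comps, Nat.card_congr e]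

end Wiring

/-! ### Skein evaluation of bigons and triangles. -/

namespace Wiring

variable {E : Type} {R : Type*}

/-- The edge of `b` is not the root, is not paired, and does not matter for the weight. -/
structure Inner (r : E) (U : (E × Bool → ℤ) → R) (P₀ : E × Bool → E × Bool → Prop)
    (b : E × Bool) : Prop where
  ne_root : b.1 ≠ r
  avoids : Avoids P₀ b
  weight : ∀ W W', (∀ d, d.1 ≠ b.1 → W d = W' d) → U W = U W'

theorem Inner.symm {r : E} {U : (E × Bool → ℤ) → R} {P₀ : E × Bool → E × Bool → Prop}
    {b : E × Bool} (h : Inner r U P₀ b) : Inner r U P₀ (opp b) := ⟨h.1, h.2, h.3⟩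

variable [CommRing R]

/-- Both lists matter only up to `SamePairs`, so an application has to name only the ends that
become joined, and the reordering is left to `simp`. -/
theorem Inner.contract [Finite E] {r : E} {U : (E × Bool → ℤ) → R}
    {P₀ : E × Bool → E × Bool → Prop} {b : E × Bool} (h : Inner r U P₀ b) (δ : R)
    (L : List ((E × Bool) × (E × Bool))) {L₁ L₂ : List ((E × Bool) × (E × Bool))} (a c : E × Bool)
    (h₁ : SamePairs L₁ ((a, b) :: (opp b, c) :: L)) (h₂ : SamePairs L₂ ((a, c) :: L))
    (ha : a.1 ≠ b.1 ∧ c.1 ≠ b.1 ∧ ∀ p ∈ L, p.1.1 ≠ b.1 ∧ p.2.1 ≠ b.1) :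
    δ * eval r δ U (add P₀ L₁) = eval r δ U (add P₀ L₂) := by
  rw [eval_add_congr r δ U P₀ h₁, eval_add_congr r δ U P₀ h₂,
    eval_contract r δ U P₀ L h.ne_root ha.1 ha.2.1 h.avoids ha.2.2 h.weight]

/-- The pairs at a crossing whose opposite ends are `p`, `i` and `q`, `j`: the splitting which
separates the corner between `p` and `q` if `t = true`, and the other one if `t = false`. -/
def corner (t : Bool) (p q i j : E × Bool) : List ((E × Bool) × (E × Bool)) :=
  if t then [(p, q), (i, j)] else [(p, j), (i, q)]

/-- After multiplication by `δ ^ 2` both inner edges are contracted, and only the outer pairings `X`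
and `Y` remain. `X` has the coefficient `α * β = 1`, as for two strands passing straight through.
`Y` has the coefficient `α ^ 2 + β ^ 2 + δ = 0`, the `δ` coming from the splitting in which the
inner edges form a circle. -/
theorem eval_bigon [Finite E] [IsDomain R] {r : E} {U : (E × Bool → ℤ) → R}
    {P₀ : E × Bool → E × Bool → Prop} {a a' b b' e g : E × Bool} {α β δ : R}
    (he : Inner r U P₀ e) (hg : Inner r U P₀ g) (hαβ : α * β = 1) (hδ : δ = -α ^ 2 - β ^ 2)
    (hδ0 : δ ≠ 0) (heg : e.1 ≠ g.1) (ho : ∀ d ∈ [a, a', b, b'], d.1 ≠ e.1 ∧ d.1 ≠ g.1) :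
    ∑ s : Bool, ∑ t : Bool, (if s then β else α) * (if t then α else β) *
      eval r δ U (add P₀ (corner s a a' e g ++ corner t b b' (opp e) (opp g))) =
    eval r δ U (add P₀ [(a, e), (opp e, b), (a', g), (opp g, b')]) := by
  have hge := heg.symm
  simp only [List.mem_cons, List.not_mem_nil, or_false, forall_eq_or_imp, forall_eq] at ho
  obtain ⟨⟨ha1, ha2⟩, ⟨ha1', ha2'⟩, ⟨hb1, hb2⟩, hb1', hb2'⟩ := ho
  set X := eval r δ U (add P₀ [(a, b), (a', b')]) with hX
  set Y := eval r δ U (add P₀ [(a, a'), (b, b')]) with hY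
  have h0 : δ * (δ * eval r δ U (add P₀ [(a, e), (opp e, b), (a', g), (opp g, b')])) = X := by
    rw [he.contract δ [(a', g), (opp g, b')] a b (L₂ := [(a, b), (a', g), (opp g, b')]),
      hg.contract δ [(a, b)] a' b'] <;> simp [SamePairs, *]
  have h22 : δ * (δ * eval r δ U (add P₀ (corner false a a' e g ++
      corner false b b' (opp e) (opp g)))) = X := by
    rw [hg.contract δ [(a', e), (opp e, b')] a b (L₂ := [(a, b), (a', e), (opp e, b')]),
      he.contract δ [(a, b)] a' b'] <;> simp [SamePairs, corner, *]
  have h12 : δ * (δ * eval r δ U (add P₀ (corner true a a' e g ++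
      corner false b b' (opp e) (opp g)))) = Y := by
    rw [hg.contract δ [(a, a'), (opp e, b')] e b (L₂ := [(b, e), (a, a'), (opp e, b')]),
      he.contract δ [(a, a')] b b'] <;> simp [SamePairs, corner, *]
  have h21 : δ * (δ * eval r δ U (add P₀ (corner false a a' e g ++
      corner true b b' (opp e) (opp g)))) = Y := by
    rw [hg.contract δ [(e, a'), (b, b')] a (opp e) (L₂ := [(a, opp e), (e, a'), (b, b')]),
      he.symm.contract δ [(b, b')] a a'] <;> simp [SamePairs, corner, *]
  have h11 : δ * eval r δ U (add P₀ (corner true a a' e g ++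
      corner true b b' (opp e) (opp g))) = Y := by
    rw [hg.contract δ [(a, a'), (b, b')] e (opp e)] <;> simp [SamePairs, corner, *]
  apply mul_left_cancel₀ (mul_ne_zero hδ0 hδ0)
  simp only [Fintype.sum_bool, if_true, if_false, Bool.false_eq_true]
  linear_combination α * β * h22 + β ^ 2 * h12 + α ^ 2 * h21 + δ * β * α * h11 - h0 +
    (X + δ * Y) * hαβ + Y * hδ

/-- The pairs at the three corners of a triangle with sides `u`, `v`, `w`. -/
def triangle (s t k : Bool) (p₁ p₂ p₃ p₄ p₅ p₆ u v w : E × Bool) :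
    List ((E × Bool) × (E × Bool)) :=
  corner s p₁ p₂ u (opp w) ++ corner t p₃ p₄ v (opp u) ++ corner k p₅ p₆ w (opp v)

theorem samePairs_triangle_rotate (s t k : Bool) (p₁ p₂ p₃ p₄ p₅ p₆ u v w : E × Bool) :
    SamePairs (triangle s t k p₁ p₂ p₃ p₄ p₅ p₆ u v w)
      (triangle t k s p₃ p₄ p₅ p₆ p₁ p₂ v w u) := by
  constructor <;> intro p hp <;> simp only [triangle, List.mem_append] at hp ⊢ <;> tauto

section Triangle

variable {r : E} {U : (E × Bool → ℤ) → R}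
  {P₀ : E × Bool → E × Bool → Prop} {p₁ p₂ p₃ p₄ p₅ p₆ u v w : E × Bool}

/-- The sides `u`, `v`, `w` are different inner edges, and the ends of other edges are given. -/
structure IsTriangle (r : E) (U : (E × Bool → ℤ) → R) (P₀ : E × Bool → E × Bool → Prop)
    (p₁ p₂ p₃ p₄ p₅ p₆ u v w : E × Bool) : Prop where
  inner₁ : Inner r U P₀ u
  inner₂ : Inner r U P₀ v
  inner₃ : Inner r U P₀ w
  ne₁₂ : u.1 ≠ v.1
  ne₂₃ : v.1 ≠ w.1
  ne₃₁ : w.1 ≠ u.1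
  outer : ∀ d ∈ [p₁, p₂, p₃, p₄, p₅, p₆], d.1 ≠ u.1 ∧ d.1 ≠ v.1 ∧ d.1 ≠ w.1

omit [CommRing R] in
theorem IsTriangle.rotate (h : IsTriangle r U P₀ p₁ p₂ p₃ p₄ p₅ p₆ u v w) :
    IsTriangle r U P₀ p₃ p₄ p₅ p₆ p₁ p₂ v w u := by
  refine ⟨h.2, h.3, h.1, h.5, h.6, h.4, fun d hd => ?_⟩
  have := h.outer d (by simp only [List.mem_cons] at hd ⊢; tauto)
  tauto

omit [CommRing R] in
theorem IsTriangle.reflect (h : IsTriangle r U P₀ p₁ p₂ p₃ p₄ p₅ p₆ u v w) :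
    IsTriangle r U P₀ p₄ p₅ p₆ p₁ p₂ p₃ (opp u) (opp v) (opp w) := by
  refine ⟨h.1.symm, h.2.symm, h.3.symm, h.4, h.5, h.6, fun d hd => ?_⟩
  have := h.outer d (by simp only [List.mem_cons] at hd ⊢; tauto)
  tauto

/-- The sides close up to a circle. Two contractions shrink it to `v` with its ends joined, so there
is one factor `δ` less than for the other splittings. -/
theorem eval_triangle_ttt [Finite E] (h : IsTriangle r U P₀ p₁ p₂ p₃ p₄ p₅ p₆ u v w) (δ : R) :
    δ * (δ * eval r δ U (add P₀ (triangle true true true p₁ p₂ p₃ p₄ p₅ p₆ u v w))) =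
      eval r δ U (add P₀ [(p₁, p₂), (p₃, p₄), (p₅, p₆)]) := by
  obtain ⟨hu, hv, hw, h1, h2, h3, ho⟩ := h
  have h1' := h1.symm
  have h2' := h2.symm
  have h3' := h3.symm
  simp only [List.mem_cons, List.not_mem_nil, or_false, forall_eq_or_imp, forall_eq] at ho
  rw [hu.contract δ [(p₁, p₂), (p₃, p₄), (p₅, p₆), (w, opp v)] (opp w) v
      (L₂ := [(v, opp w), (w, opp v), (p₁, p₂), (p₃, p₄), (p₅, p₆)]),
    hw.symm.contract δ [(p₁, p₂), (p₃, p₄), (p₅, p₆)] v (opp v)] <;>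
    simp [SamePairs, triangle, corner, *]

theorem eval_triangle_ttf [Finite E] (h : IsTriangle r U P₀ p₁ p₂ p₃ p₄ p₅ p₆ u v w) (δ : R) :
    δ * (δ * (δ * eval r δ U (add P₀ (triangle true true false p₁ p₂ p₃ p₄ p₅ p₆ u v w)))) =
      eval r δ U (add P₀ [(p₁, p₂), (p₃, p₄), (p₅, p₆)]) := by
  obtain ⟨hu, hv, hw, h1, h2, h3, ho⟩ := h
  have h1' := h1.symm
  have h2' := h2.symm
  have h3' := h3.symm
  simp only [List.mem_cons, List.not_mem_nil, or_false, forall_eq_or_imp, forall_eq] at ho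
  rw [hv.symm.contract δ [(p₁, p₂), (p₃, p₄), (u, opp w), (w, p₆)] p₅ (opp u)
      (L₂ := [(p₅, opp u), (u, opp w), (p₁, p₂), (p₃, p₄), (w, p₆)]),
    hu.symm.contract δ [(p₁, p₂), (p₃, p₄), (w, p₆)] p₅ (opp w)
      (L₂ := [(p₅, opp w), (w, p₆), (p₁, p₂), (p₃, p₄)]),
    hw.symm.contract δ [(p₁, p₂), (p₃, p₄)] p₅ p₆] <;>
    simp [SamePairs, triangle, corner, *]

theorem eval_triangle_tff [Finite E] (h : IsTriangle r U P₀ p₁ p₂ p₃ p₄ p₅ p₆ u v w) (δ : R) :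
    δ * (δ * (δ * eval r δ U (add P₀ (triangle true false false p₁ p₂ p₃ p₄ p₅ p₆ u v w)))) =
      eval r δ U (add P₀ [(p₁, p₂), (p₃, p₆), (p₄, p₅)]) := by
  obtain ⟨hu, hv, hw, h1, h2, h3, ho⟩ := h
  have h1' := h1.symm
  have h2' := h2.symm
  have h3' := h3.symm
  simp only [List.mem_cons, List.not_mem_nil, or_false, forall_eq_or_imp, forall_eq] at ho
  rw [hu.symm.contract δ [(p₁, p₂), (v, p₄), (p₅, opp v), (w, p₆)] p₃ (opp w)
      (L₂ := [(p₃, opp w), (w, p₆), (p₁, p₂), (v, p₄), (p₅, opp v)]),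
    hw.symm.contract δ [(p₁, p₂), (v, p₄), (p₅, opp v)] p₃ p₆
      (L₂ := [(p₅, opp v), (v, p₄), (p₁, p₂), (p₃, p₆)]),
    hv.symm.contract δ [(p₁, p₂), (p₃, p₆)] p₅ p₄] <;>
    simp [SamePairs, triangle, corner, *]

theorem eval_triangle_fff [Finite E] (h : IsTriangle r U P₀ p₁ p₂ p₃ p₄ p₅ p₆ u v w) (δ : R) :
    δ * (δ * (δ * eval r δ U (add P₀ (triangle false false false p₁ p₂ p₃ p₄ p₅ p₆ u v w)))) =
      eval r δ U (add P₀ [(p₂, p₃), (p₄, p₅), (p₆, p₁)]) := by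
  obtain ⟨hu, hv, hw, h1, h2, h3, ho⟩ := h
  have h1' := h1.symm
  have h2' := h2.symm
  have h3' := h3.symm
  simp only [List.mem_cons, List.not_mem_nil, or_false, forall_eq_or_imp, forall_eq] at ho
  rw [hu.symm.contract δ [(p₁, opp w), (w, p₆), (v, p₄), (p₅, opp v)] p₃ p₂
      (L₂ := [(p₁, opp w), (w, p₆), (v, p₄), (p₅, opp v), (p₃, p₂)]),
    hw.symm.contract δ [(v, p₄), (p₅, opp v), (p₃, p₂)] p₁ p₆
      (L₂ := [(p₅, opp v), (v, p₄), (p₃, p₂), (p₁, p₆)]),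
    hv.symm.contract δ [(p₃, p₂), (p₁, p₆)] p₅ p₄] <;>
    simp [SamePairs, triangle, corner, *]

/-- The sum over all splittings of the corners of a triangle between a top, a middle and a bottom
strand. -/
noncomputable def triangleSum (r : E) (U : (E × Bool → ℤ) → R) (P₀ : E × Bool → E × Bool → Prop)
    (α β δ : R) (p₁ p₂ p₃ p₄ p₅ p₆ u v w : E × Bool) : R :=
  ∑ s : Bool, ∑ t : Bool, ∑ k : Bool,
    (if s then β else α) * (if t then α else β) * (if k then β else α) *
      eval r δ U (add P₀ (triangle s t k p₁ p₂ p₃ p₄ p₅ p₆ u v w))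

/-- The right-hand side runs over the five planar pairings of six cyclically ordered ends. The first
one comes from the four splittings with at most one `false`, with total coefficient `δ * β + 2 * α +
β ^ 3 = α`; each of the others comes from a single splitting. -/
theorem triangleSum_eq [Finite E] (h : IsTriangle r U P₀ p₁ p₂ p₃ p₄ p₅ p₆ u v w) {α β δ : R}
    (hαβ : α * β = 1) (hδ : δ = -α ^ 2 - β ^ 2) :
    δ ^ 3 * triangleSum r U P₀ α β δ p₁ p₂ p₃ p₄ p₅ p₆ u v w =
      α * eval r δ U (add P₀ [(p₁, p₂), (p₃, p₄), (p₅, p₆)]) +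
      α * eval r δ U (add P₀ [(p₂, p₃), (p₄, p₅), (p₆, p₁)]) +
      β * eval r δ U (add P₀ [(p₁, p₂), (p₃, p₆), (p₄, p₅)]) +
      α ^ 3 * eval r δ U (add P₀ [(p₃, p₄), (p₅, p₂), (p₆, p₁)]) +
      β * eval r δ U (add P₀ [(p₅, p₆), (p₁, p₄), (p₂, p₃)]) := by
  have rot : ∀ s t k, eval r δ U (add P₀ (triangle s t k p₁ p₂ p₃ p₄ p₅ p₆ u v w)) =
      eval r δ U (add P₀ (triangle t k s p₃ p₄ p₅ p₆ p₁ p₂ v w u)) := fun s t k =>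
    eval_add_congr r δ U P₀ (samePairs_triangle_rotate ..)
  have rot' : ∀ s t k, eval r δ U (add P₀ (triangle s t k p₁ p₂ p₃ p₄ p₅ p₆ u v w)) =
      eval r δ U (add P₀ (triangle k s t p₅ p₆ p₁ p₂ p₃ p₄ w u v)) := fun s t k =>
    (rot s t k).trans (eval_add_congr r δ U P₀ (samePairs_triangle_rotate ..))
  have ttt := eval_triangle_ttt h δ
  have ttf := eval_triangle_ttf h δ
  have ftt := eval_triangle_ttf h.rotate δ
  have tft := eval_triangle_ttf h.rotate.rotate δ
  have tff := eval_triangle_tff h δ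
  have ftf := eval_triangle_tff h.rotate δ
  have fft := eval_triangle_tff h.rotate.rotate δ
  have fff := eval_triangle_fff h δ
  rw [← rot, eval_add_congr r δ U P₀ (L := [(p₃, p₄), (p₅, p₆), (p₁, p₂)])
    (L' := [(p₁, p₂), (p₃, p₄), (p₅, p₆)]) (by simp [SamePairs])] at ftt
  rw [← rot', eval_add_congr r δ U P₀ (L := [(p₅, p₆), (p₁, p₂), (p₃, p₄)])
    (L' := [(p₁, p₂), (p₃, p₄), (p₅, p₆)]) (by simp [SamePairs])] at tft
  rw [← rot] at ftf
  rw [← rot'] at fft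
  simp only [triangleSum, Fintype.sum_bool, if_true, if_false, Bool.false_eq_true]
  set M₁ := eval r δ U (add P₀ [(p₁, p₂), (p₃, p₄), (p₅, p₆)])
  set M₂ := eval r δ U (add P₀ [(p₂, p₃), (p₄, p₅), (p₆, p₁)])
  set N₁ := eval r δ U (add P₀ [(p₁, p₂), (p₃, p₆), (p₄, p₅)])
  set N₃ := eval r δ U (add P₀ [(p₅, p₆), (p₁, p₄), (p₂, p₃)])
  linear_combination δ * β * α * β * ttt + β * α * α * ttf + α * α * β * ftt +
    β * β * β * tft + β * β * α * tff + α * α * α * ftf + α * β * β * fft + α * β * α * fff +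
    ((δ * β + α) * M₁ + β * N₁ + β * N₃ + α * M₂) * hαβ + β * M₁ * hδ

/-- The half turn `pᵢ ↦ pᵢ₊₃` interchanges the first two pairings of `triangleSum_eq`, which both
have coefficient `α`, and fixes the other three. This is the algebra behind the third Reidemeister
move. -/
theorem triangleSum_reflect [Finite E] [IsDomain R] (h : IsTriangle r U P₀ p₁ p₂ p₃ p₄ p₅ p₆ u v w)
    {α β δ : R} (hαβ : α * β = 1) (hδ : δ = -α ^ 2 - β ^ 2) (hδ0 : δ ≠ 0) :
    triangleSum r U P₀ α β δ p₄ p₅ p₆ p₁ p₂ p₃ (opp u) (opp v) (opp w) =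
      triangleSum r U P₀ α β δ p₁ p₂ p₃ p₄ p₅ p₆ u v w := by
  apply mul_left_cancel₀ (pow_ne_zero 3 hδ0)
  rw [triangleSum_eq h hαβ hδ, triangleSum_eq h.reflect hαβ hδ]
  rw [eval_add_congr r δ U P₀ (L := [(p₅, p₆), (p₁, p₂), (p₃, p₄)])
      (L' := [(p₁, p₂), (p₃, p₄), (p₅, p₆)]) (by simp [SamePairs]),
    eval_add_congr r δ U P₀ (L := [(p₄, p₅), (p₆, p₁), (p₂, p₃)])
      (L' := [(p₂, p₃), (p₄, p₅), (p₆, p₁)]) (by simp [SamePairs]),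
    eval_add_congr r δ U P₀ (L := [(p₄, p₅), (p₆, p₃), (p₁, p₂)])
      (L' := [(p₁, p₂), (p₃, p₆), (p₄, p₅)]) (by simp [SamePairs]),
    eval_add_congr r δ U P₀ (L := [(p₆, p₁), (p₂, p₅), (p₃, p₄)])
      (L' := [(p₃, p₄), (p₅, p₂), (p₆, p₁)]) (by simp [SamePairs]),
    eval_add_congr r δ U P₀ (L := [(p₂, p₃), (p₄, p₁), (p₅, p₆)])
      (L' := [(p₅, p₆), (p₁, p₄), (p₂, p₃)]) (by simp [SamePairs])]
  ring

end Triangle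

end Wiring

/-! ### Independence of the shortcut -/

namespace ArcCode

variable (U : ArcCode)

instance : Finite U.Region := Quot.finite _

/-- The coboundary of a function on the regions: its jumps across the edges. -/
noncomputable def jump : (U.Region → ℚ) →ₗ[ℚ] (U.Edge → ℚ) where
  toFun f q := f (U.leftRegion (q, true)) - f (U.leftRegion (q, false))
  map_add' f g := by
    funext q
    simp only [Pi.add_apply]
    ring
  map_smul' a f := by
    funext q
    simp only [Pi.smul_apply, smul_eq_mul, RingHom.id_apply]
    ring

/-- The boundary of a 1-chain, with its coefficient at the leg and at the double points. -/
noncomputable def boundary : (U.Edge → ℚ) →ₗ[ℚ] (Option (Fin U.n) → ℚ) where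
  toFun w v := v.elim (w none) fun c =>
    w (U.next.symm (some (c, true))) + w (U.next.symm (some (c, false))) -
      w (some (c, true)) - w (some (c, false))
  map_add' f g := by
    funext v
    cases v <;> simp
    ring
  map_smul' a f := by
    funext v
    cases v <;> simp
    ring

theorem leftRegion_in_true (c : Fin U.n) : U.leftRegion (U.next.symm (some (c, true)), true) =
    U.leftRegion (some (c, false), true) := by
  rw [← U.leftRegion_faceStep]
  simp [faceStep]

theorem leftRegion_in_false (c : Fin U.n) : U.leftRegion (U.next.symm (some (c, false)), true) =
    U.leftRegion (U.next.symm (some (c, true)), false) := by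
  rw [← U.leftRegion_faceStep]
  simp [faceStep]

theorem leftRegion_out_true (c : Fin U.n) : U.leftRegion (some (c, true), false) =
    U.leftRegion (U.next.symm (some (c, false)), false) := by
  rw [← U.leftRegion_faceStep]
  simp [faceStep]

theorem leftRegion_out_false (c : Fin U.n) : U.leftRegion (some (c, false), false) =
    U.leftRegion (some (c, true), true) := by
  rw [← U.leftRegion_faceStep]
  simp [faceStep]

/-- The jumps add up to zero around a double point, and both sides of the leg edge belong to the
same region. -/
theorem boundary_jump (f : U.Region → ℚ) : U.boundary (U.jump f) = 0 := by
  funext v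
  rcases v with _ | c
  · have : U.leftRegion (none, false) = U.leftRegion (none, true) := by
      rw [← U.leftRegion_faceStep]
      simp [faceStep]
    simp [boundary, jump, this]
  · simp only [boundary, jump, LinearMap.coe_mk, AddHom.coe_mk, Option.elim, Pi.zero_apply,
      U.leftRegion_in_true, U.leftRegion_in_false, U.leftRegion_out_true, U.leftRegion_out_false]
    ring

/-- A walk on the left side of the curve past a double point crosses one edge of the other strand:
the outgoing edge of strand `false` here, the incoming edge of strand `true` in
`jump_passage_false`. -/
theorem jump_passage_true (f : U.Region → ℚ) (c : Fin U.n) :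
    f (U.leftRegion (some (c, true), true)) -
      f (U.leftRegion (U.next.symm (some (c, true)), true)) = -U.jump f (some (c, false)) := by
  simp only [jump, LinearMap.coe_mk, AddHom.coe_mk, U.leftRegion_in_true, U.leftRegion_out_false]
  ring

theorem jump_passage_false (f : U.Region → ℚ) (c : Fin U.n) :
    f (U.leftRegion (some (c, false), true)) -
      f (U.leftRegion (U.next.symm (some (c, false)), true)) =
      U.jump f (U.next.symm (some (c, true))) := by
  simp only [jump, LinearMap.coe_mk, AddHom.coe_mk, U.leftRegion_in_true, U.leftRegion_in_false]

variable {U}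

theorem IsArc.induction (h : U.IsArc) {p : U.Edge → Prop} (h₀ : p none)
    (hs : ∀ a, p (U.next.symm (some a)) → p (some a)) (q : U.Edge) : p q := by
  obtain ⟨m, rfl⟩ := h q
  induction m with
  | zero => exact h₀
  | succ m ih =>
    rw [Function.iterate_succ_apply']
    rcases hq : U.next (U.next^[m] none) with _ | a
    · exact h₀
    · apply hs
      rwa [← hq, Equiv.symm_apply_apply]

theorem ker_jump_le (h : U.IsArc) : LinearMap.ker U.jump ≤ ℚ ∙ (fun _ => 1 : U.Region → ℚ) := by
  intro f hf
  rw [LinearMap.mem_ker] at hf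
  have h1 : ∀ q, f (U.leftRegion (q, true)) = f (U.leftRegion (none, true)) := by
    refine h.induction rfl ?_
    rintro ⟨c, _ | _⟩ ih
    · have := U.jump_passage_false f c
      rw [hf, Pi.zero_apply] at this
      linarith
    · have := U.jump_passage_true f c
      rw [hf, Pi.zero_apply] at this
      linarith
  refine Submodule.mem_span_singleton.2 ⟨f (U.leftRegion (none, true)), ?_⟩
  funext x
  obtain ⟨⟨q, b⟩, rfl⟩ : ∃ d, U.leftRegion d = x := Quot.exists_rep x
  cases b
  · have := congrFun hf q
    simp only [jump, LinearMap.coe_mk, AddHom.coe_mk, Pi.zero_apply, h1] at this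
    simp only [Pi.smul_apply, smul_eq_mul]
    linarith
  · simp [h1]

/-- Dually, a functional that kills all boundaries takes equal values at the two ends of every edge.
The head, which `boundary` leaves out, counts as 0, and the curve connects every vertex with it. -/
theorem boundary_surjective (h : U.IsArc) : Function.Surjective U.boundary := by
  rw [← LinearMap.dualMap_injective_iff, injective_iff_map_eq_zero]
  intro φ hφ
  set g : Option (Fin U.n) → ℚ := fun v => φ (Pi.single v 1) with hg
  have hφg : ∀ x, φ x = ∑ v, x v * g v := by
    intro x
    conv_lhs => rw [pi_eq_sum_univ' x]
    simp [hg]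
  let G : U.Edge → ℚ := fun q => q.elim 0 fun p => g (some p.1)
  -- `G` gives the value at the end of an edge and `H` the value at its start. The sign at the leg
  -- appears because `boundary` counts the outgoing edge positively there and negatively at double
  -- points.
  let H : U.Edge → ℚ := fun q => q.elim (-g none) fun p => g (some p.1)
  have key : ∀ w : U.Edge → ℚ, ∑ q, (G (U.next q) - H q) * w q = 0 := by
    intro w
    have h1 : φ (U.boundary w) = 0 := by
      have := LinearMap.congr_fun hφ w
      simpa using this
    have h2 : ∑ q, G (U.next q) * w q = ∑ q, G q * w (U.next.symm q) := by
      rw [← Equiv.sum_comp U.next fun q => G q * w (U.next.symm q)]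
      simp
    simp only [sub_mul, Finset.sum_sub_distrib, h2]
    rw [← h1, hφg]
    simp only [Fintype.sum_option, Fintype.sum_prod_type, Fintype.sum_bool, G, H, boundary,
      LinearMap.coe_mk, AddHom.coe_mk, Option.elim]
    have h3 : ∀ x, (w (U.next.symm (some (x, true))) + w (U.next.symm (some (x, false))) -
        w (some (x, true)) - w (some (x, false))) * g (some x) =
        (g (some x) * w (U.next.symm (some (x, true))) +
          g (some x) * w (U.next.symm (some (x, false)))) -
        (g (some x) * w (some (x, true)) + g (some x) * w (some (x, false))) := fun x => by ring
    simp only [h3, Finset.sum_sub_distrib]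
    ring
  have step : ∀ q, H q = G (U.next q) := by
    intro q
    have := key (Pi.single q 1)
    simp only [Pi.single_apply, mul_ite, mul_one, mul_zero, Finset.sum_ite_eq', Finset.mem_univ,
      if_true] at this
    linarith
  have const : ∀ q, H q = H none := by
    refine h.induction rfl fun a ha => ?_
    rw [← ha, step (U.next.symm _), Equiv.apply_symm_apply]
    rfl
  have zero : ∀ q, H q = 0 := by
    intro q
    rw [const, ← const U.headEdge, step]
    simp [headEdge, G]
  have hg0 : ∀ v, g v = 0 := by
    rintro (_ | c)
    · have := zero none
      simpa [H] using this
    · exact zero (some (c, true))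
  ext v
  simp [hφg, hg0]

/-- Every cycle on the sphere is a boundary. -/
theorem range_jump (h : U.IsArc) (hs : U.IsSpherical) :
    LinearMap.range U.jump = LinearMap.ker U.boundary := by
  have := Fintype.ofFinite U.Region
  -- The range of `jump` has dimension at least (n + 1) - 1, and the kernel of `boundary` has
  -- dimension (2 n + 1) - (n + 1); both numbers are n.
  refine Submodule.eq_of_le_of_finrank_le ?_ ?_
  · rintro _ ⟨f, rfl⟩
    exact U.boundary_jump f
  · have h1 := U.jump.finrank_range_add_finrank_ker
    have h2 := U.boundary.finrank_range_add_finrank_ker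
    have h3 := (Submodule.finrank_mono (ker_jump_le h)).trans ((finrank_span_le_card _).trans
      (by simp : _ ≤ 1))
    rw [LinearMap.range_eq_top.2 (boundary_surjective h), finrank_top] at h2
    rw [Module.finrank_fintype_fun_eq_card] at h1
    rw [Module.finrank_fintype_fun_eq_card, Module.finrank_fintype_fun_eq_card] at h2
    rw [IsSpherical, Nat.card_eq_fintype_card] at hs
    simp only [Fintype.card_option, Fintype.card_prod, Fintype.card_fin, Fintype.card_bool] at h2
    omega

theorem IsPath.sum_jump {f : U.Region → ℚ} {w : U.Edge → ℤ} (hw : ∀ q, U.jump f q = w q)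
    {r r' : U.Region} {l : List U.Dart} (h : U.IsPath r l r') :
    (((l.map fun d => w d.1 * if d.2 then -1 else 1).sum : ℤ) : ℚ) = f r' - f r := by
  induction l generalizing r with
  | nil =>
    rw [show r = r' from h]
    simp
  | cons d l ih =>
    rw [List.map_cons, List.sum_cons, Int.cast_add, ih h.2, h.1]
    obtain ⟨q, b⟩ := d
    have := hw q
    simp only [jump, LinearMap.coe_mk, AddHom.coe_mk] at this
    cases b <;> simp only [Dart.reverse, Bool.not_true, Bool.not_false, if_true, if_false,
      Bool.false_eq_true, Int.cast_mul, Int.cast_neg, Int.cast_one, ← this] <;> ring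

/-- The intersection number of a cycle with a shortcut, computed with a parallel copy of the
curve on its left-hand side. -/
theorem Shortcut.sum_cycle (h : U.IsArc) (hs : U.IsSpherical) (α : U.Shortcut) (w : U.Edge → ℤ)
    (h₀ : w none = 0) (hc : ∀ c, w (U.next.symm (some (c, true))) +
      w (U.next.symm (some (c, false))) = w (some (c, true)) + w (some (c, false))) :
    (α.crossed.map fun d => w d.1 * if d.2 then -1 else 1).sum =
      ∑ c, (w (U.next.symm (some (c, true))) - w (some (c, false))) := by
  obtain ⟨f, hf⟩ : (fun q => (w q : ℚ)) ∈ LinearMap.range U.jump := by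
    rw [range_jump h hs, LinearMap.mem_ker]
    funext v
    rcases v with _ | c
    · simp [boundary, h₀]
    · have : ((w (U.next.symm (some (c, true))) + w (U.next.symm (some (c, false))) : ℤ) : ℚ) =
        ((w (some (c, true)) + w (some (c, false)) : ℤ) : ℚ) := by rw [hc]
      push_cast at this
      simp only [boundary, LinearMap.coe_mk, AddHom.coe_mk, Option.elim, Pi.zero_apply]
      linarith
  have hw : ∀ q, U.jump f q = w q := congrFun hf
  have h1 := IsPath.sum_jump hw α.isPath
  set F : U.Edge → ℚ := fun q => f (U.leftRegion (q, true)) with hF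
  -- The sum telescopes along the curve: every edge except the first starts after a passage, and
  -- every edge except the last ends at one.
  have h2 : ∑ p : Fin U.n × Bool, (F (some p) - F (U.next.symm (some p))) =
      F U.headEdge - F none := by
    have e1 : ∑ q, F (U.next.symm q) = ∑ q, F q := Equiv.sum_comp U.next.symm F
    rw [Fintype.sum_option, Fintype.sum_option] at e1
    rw [Finset.sum_sub_distrib, headEdge]
    linarith
  have h3 : (∑ c, (w (U.next.symm (some (c, true))) - w (some (c, false))) : ℤ) =
      F U.headEdge - F none := by
    rw [← h2, Fintype.sum_prod_type, Int.cast_sum]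
    refine Finset.sum_congr rfl fun c _ => ?_
    rw [Fintype.sum_bool, hF, U.jump_passage_true, U.jump_passage_false, hw, hw]
    push_cast
    ring
  rw [← h3] at h1
  exact_mod_cast h1

end ArcCode

/-! ### The smoothed curve as a wiring -/

open Wiring

namespace Wiring

variable {ι E : Type} (st : Bool → ι × Bool → E × Bool)

/-- The pairs of ends which are joined at a double point: with a splitting which respects the
orientation (`some true`) or does not (`some false`), or without splitting (`none`). The incoming
and the outgoing end at the passage `p` are `st true p` and `st false p`. -/
def pairs (k : Option Bool) (c : ι) : List ((E × Bool) × (E × Bool)) :=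
  match k with
  | some true => [(st true (c, true), st false (c, false)), (st true (c, false), st false (c, true))]
  | some false => [(st true (c, true), st true (c, false)), (st false (c, true), st false (c, false))]
  | none => [(st true (c, true), st false (c, true)), (st true (c, false), st false (c, false))]

/-- The pairing of ends in which the double point `c` is treated according to `κ c`. -/
def Linked (κ : ι → Option Bool) (d d' : E × Bool) : Prop := ∃ c, (d, d') ∈ pairs st (κ c) c

/-- The pairing `Linked` at the double points outside `S`. -/
def LinkedOff (S : Finset ι) (κ : ι → Option Bool) (d d' : E × Bool) : Prop :=
  ∃ c ∉ S, (d, d') ∈ pairs st (κ c) c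

/-- The contribution of a double point to the intersection number of a flow with the shortcut
parallel to the curve. -/
def crossingFlow (W : E × Bool → ℤ) (c : ι) : ℤ := W (st true (c, true)) + W (st false (c, false))

noncomputable def weight [Fintype ι] (W : E × Bool → ℤ) : BracketRing :=
  uPow (-∑ c, crossingFlow st W c)

variable {st}

theorem exists_stub_of_mem_pairs {k : Option Bool} {c : ι} {d d' : E × Bool}
    (h : (d, d') ∈ pairs st k c) : ∃ b e b' e', d = st b (c, e) ∧ d' = st b' (c, e') := by
  match k with
  | some true | some false | none =>
    simp only [pairs, List.mem_cons, Prod.mk.injEq, List.not_mem_nil, or_false] at h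
    rcases h with ⟨rfl, rfl⟩ | ⟨rfl, rfl⟩ <;> exact ⟨_, _, _, _, rfl, rfl⟩

/-- For each of the three treatments of `c`, its four ends form two pairs, and each pair has total
flow zero. -/
theorem IsFlow.kirchhoff {κ : ι → Option Bool} {W : E × Bool → ℤ} {r : E}
    (h : IsFlow (Linked st κ) r W) (c : ι) :
    W (st true (c, true)) + W (st true (c, false)) +
      (W (st false (c, true)) + W (st false (c, false))) = 0 := by
  have key : ∀ p ∈ pairs st (κ c) c, W p.1 = -W p.2 := fun p hp => h.pair _ _ ⟨c, hp⟩
  rcases hk : κ c with _ | _ | _ <;> rw [hk] at key <;>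
    simp only [pairs, List.mem_cons, List.not_mem_nil, or_false, forall_eq_or_imp,
      forall_eq] at key <;> omega

end Wiring

namespace ArcCode

variable (U : ArcCode)

/-- The end of an edge at a double point: the incoming one of the passage `p` if `b = true`, and
the outgoing one if `b = false`. -/
def stub (b : Bool) (p : Fin U.n × Bool) : U.Dart :=
  if b then (U.next.symm (some p), false) else (some p, true)

theorem stub_true (p : Fin U.n × Bool) : U.stub true p = (U.next.symm (some p), false) := rfl

theorem stub_false (p : Fin U.n × Bool) : U.stub false p = (some p, true) := rfl

theorem stub_inj {b b' : Bool} {p p' : Fin U.n × Bool} :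
    U.stub b p = U.stub b' p' ↔ b = b' ∧ p = p' := by
  cases b <;> cases b' <;> simp [stub]

abbrev Linked (κ : Fin U.n → Option Bool) : U.Dart → U.Dart → Prop := Wiring.Linked U.stub κ

end ArcCode

namespace KnotoidDiagram

variable {D : KnotoidDiagram}

/-- Which splittings respect the orientation. -/
def State.orientation (s : D.State) (c : Fin D.n) : Bool := s c == D.positive c

theorem State.step_opp_stub (s : D.State) (b : Bool) (c : Fin D.n) (e : Bool) :
    s.step (opp (D.stub b (c, e))) =
      some (D.stub (if s.Oriented c then !b else b) (c, !e)) := by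
  cases b
  · by_cases h : s.Oriented c <;> simp [ArcCode.stub, opp, State.step, h]
  · by_cases h : s.Oriented c <;> simp [ArcCode.stub, opp, State.step, h]

theorem State.exists_stub_of_step (s : D.State) {d d' : D.Dart} (h : s.step d = some d') :
    ∃ b c e, d = opp (D.stub b (c, e)) := by
  obtain ⟨q, _ | _⟩ := d
  · rcases q with _ | ⟨c, e⟩
    · simp [State.step] at h
    · exact ⟨false, c, e, rfl⟩
  · rcases hq : D.next q with _ | ⟨c, e⟩
    · simp [State.step, hq] at h
    · exact ⟨true, c, e, by simp [ArcCode.stub, opp, ← hq]⟩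

/-- `opp d` is the end at which the dart `d` arrives. `pairs` lists every pair in one order only,
while `step` can traverse it both ways; hence the disjunction. -/
theorem State.step_iff (s : D.State) (d d' : D.Dart) : s.step d = some d' ↔
    D.Linked (fun c => some (s.orientation c)) (opp d) d' ∨
      D.Linked (fun c => some (s.orientation c)) d' (opp d) := by
  constructor
  · intro h
    obtain ⟨b, c, e, rfl⟩ := s.exists_stub_of_step h
    rw [s.step_opp_stub, Option.some_inj] at h
    subst h
    simp only [opp_opp, ArcCode.Linked, Linked]
    by_cases ho : s.Oriented c
    · have ho' : s.orientation c = true := by simpa [State.orientation, State.Oriented] using ho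
      cases b <;> cases e
      · exact .inr ⟨c, by simp [ho, ho', pairs]⟩
      · exact .inr ⟨c, by simp [ho, ho', pairs]⟩
      · exact .inl ⟨c, by simp [ho, ho', pairs]⟩
      · exact .inl ⟨c, by simp [ho, ho', pairs]⟩
    · have ho' : s.orientation c = false := by simpa [State.orientation, State.Oriented] using ho
      cases b <;> cases e
      · exact .inr ⟨c, by simp [ho, ho', pairs]⟩
      · exact .inl ⟨c, by simp [ho, ho', pairs]⟩
      · exact .inr ⟨c, by simp [ho, ho', pairs]⟩
      · exact .inl ⟨c, by simp [ho, ho', pairs]⟩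
  · have key : ∀ x y, D.Linked (fun c => some (s.orientation c)) x y →
        s.step (opp x) = some y ∧ s.step (opp y) = some x := by
      rintro x y ⟨c, h⟩
      by_cases ho : s.Oriented c
      · have ho' : s.orientation c = true := by simpa [State.orientation, State.Oriented] using ho
        simp only [ho', pairs, List.mem_cons, Prod.mk.injEq, List.not_mem_nil,
          or_false] at h
        rcases h with ⟨rfl, rfl⟩ | ⟨rfl, rfl⟩ <;> simp [s.step_opp_stub, ho]
      · have ho' : s.orientation c = false := by
          simpa [State.orientation, State.Oriented] using ho
        simp only [ho', pairs, List.mem_cons, Prod.mk.injEq, List.not_mem_nil,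
          or_false] at h
        rcases h with ⟨rfl, rfl⟩ | ⟨rfl, rfl⟩ <;> simp [s.step_opp_stub, ho]
    rintro (h | h)
    · simpa using (key _ _ h).1
    · simpa using (key _ _ h).2

theorem State.step_reverse (s : D.State) {d d' : D.Dart} (h : s.step d = some d') :
    s.step (opp d') = some (opp d) := by
  rw [s.step_iff] at h ⊢
  rw [opp_opp]
  exact h.symm

theorem State.step_injective (s : D.State) {d₁ d₂ d' : D.Dart} (h₁ : s.step d₁ = some d')
    (h₂ : s.step d₂ = some d') : d₁ = d₂ := by
  have := (s.step_reverse h₁).symm.trans (s.step_reverse h₂)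
  exact opp_injective (Option.some_inj.1 this)

theorem State.step_ne_opp (s : D.State) (d : D.Dart) : s.step d ≠ some (opp d) := by
  intro h
  obtain ⟨b, c, e, rfl⟩ := s.exists_stub_of_step h
  rw [s.step_opp_stub, Option.some_inj, opp_opp, D.stub_inj] at h
  simp at h

theorem State.step_ne_root (s : D.State) (d : D.Dart) : s.step d ≠ some (none, true) := by
  intro h
  obtain ⟨b, c, e, rfl⟩ := s.exists_stub_of_step h
  rw [s.step_opp_stub, Option.some_inj] at h
  generalize (if s.Oriented c then !b else b) = b' at h
  cases b' <;> simp [ArcCode.stub] at h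

/-- A component does not return to an edge in the opposite direction. -/
theorem State.not_reach_opp (s : D.State) {d d' : D.Dart}
    (h : Relation.ReflTransGen (fun d d' : D.Dart => s.step d = some d') d d') : d' ≠ opp d := by
  have key : ∀ m (c : ℕ → D.Dart), (∀ i < m, s.step (c i) = some (c (i + 1))) →
      c m ≠ opp (c 0) := by
    intro m
    induction m using Nat.strong_induction_on with
    | _ m ih =>
      intro c hc h
      match m with
      | 0 => exact opp_ne _ h.symm
      | 1 => exact s.step_ne_opp (c 0) (by rw [hc 0 one_pos, h])
      -- Reversing the first step yields a step into the same dart as the last one. By injectivity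
      -- the path without its first and last step is a shorter counterexample.
      | m + 2 =>
        have h1 := s.step_reverse (hc 0 (by omega))
        have h2 := hc (m + 1) (by omega)
        rw [h] at h2
        have h3 := s.step_injective h2 h1
        exact ih m (by omega) (fun i => c (i + 1)) (fun i hi => hc (i + 1) (by omega)) h3
  have : ∃ m, ∃ c : ℕ → D.Dart, c 0 = d ∧ c m = d' ∧ ∀ i < m, s.step (c i) = some (c (i + 1)) := by
    induction h with
    | refl => exact ⟨0, fun _ => d, rfl, rfl, by simp⟩
    | @tail x y _ hxy ih =>
      obtain ⟨m, c, h0, hm, hc⟩ := ih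
      refine ⟨m + 1, fun i => if i ≤ m then c i else y, by simp [h0], by simp, fun i hi => ?_⟩
      rcases Nat.lt_or_eq_of_le (Nat.le_of_lt_succ hi) with hi' | rfl
      · simp [hi'.le, Nat.succ_le_iff.2 hi', hc i hi']
      · simp [hm, hxy]
  obtain ⟨m, c, rfl, rfl, hc⟩ := this
  exact key m c hc

theorem State.onSegment_step (s : D.State) {d d' : D.Dart} (h : s.step d = some d') :
    s.OnSegment d ↔ s.OnSegment d' := by
  constructor
  · exact fun hd => hd.tail h
  · intro hd
    rcases Relation.ReflTransGen.cases_tail hd with rfl | ⟨x, hx, hxd⟩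
    · exact (s.step_ne_root _ h).elim
    · rwa [s.step_injective h hxd]

/-- The flow along the segment component. -/
noncomputable def State.flow (s : D.State) (d : D.Dart) : ℤ :=
  if d.2 then s.segment d.1 else -s.segment d.1

open Classical in
theorem State.flow_eq (s : D.State) (d : D.Dart) : s.flow d =
    (if s.OnSegment d then 1 else 0) - (if s.OnSegment (opp d) then 1 else 0) := by
  obtain ⟨q, _ | _⟩ := d <;> simp [State.flow, State.segment, opp]

theorem State.isFlow (s : D.State) :
    IsFlow (D.Linked fun c => some (s.orientation c)) none s.flow := by
  classical
  refine ⟨?_, ?_, ?_, ?_⟩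
  · intro d
    rw [s.flow_eq, s.flow_eq, opp_opp]
    ring
  · intro d d' h
    have h1 : s.step (opp d) = some d' := (s.step_iff _ _).2 (.inl (by rwa [opp_opp]))
    have h2 : s.step (opp d') = some d := (s.step_iff _ _).2 (.inr (by rwa [opp_opp]))
    rw [s.flow_eq, s.flow_eq]
    simp only [s.onSegment_step h1, s.onSegment_step h2]
    ring
  -- Since the segment never runs back along its first edge, the two indicator terms do not cancel
  -- at the root.
  · have h1 : s.OnSegment (none, true) := Relation.ReflTransGen.refl
    have h2 : ¬ s.OnSegment (opp (none, true)) := fun h => s.not_reach_opp h rfl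
    rw [s.flow_eq, if_pos h1, if_neg h2]
    rfl
  · have key : ∀ d, s.OnSegment d → Comp.mk (D.Linked fun c => some (s.orientation c)) d.1 =
        Comp.mk (D.Linked fun c => some (s.orientation c)) none := by
      intro d hd
      induction hd with
      | refl => rfl
      | @tail x y _ hxy ih =>
        rw [← ih, ← opp_fst x]
        rcases (s.step_iff _ _).1 hxy with h | h
        · exact (Comp.sound h).symm
        · exact Comp.sound h
    intro d hd
    rw [s.flow_eq] at hd
    by_cases h : s.OnSegment d
    · exact key d h
    · by_cases h' : s.OnSegment (opp d)
      · exact key (opp d) h'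
      · simp [h, h'] at hd

theorem State.card_component (s : D.State) :
    Nat.card s.Component = comps (D.Linked fun c => some (s.orientation c)) := by
  set P := D.Linked fun c => some (s.orientation c)
  have h1 : ∀ q q' : D.Edge, (∃ e e' : Bool, s.step (q, e) = some (q', e')) →
      Comp.mk P q = Comp.mk P q' := by
    rintro q q' ⟨e, e', h⟩
    rcases (s.step_iff _ _).1 h with h | h
    · exact Comp.sound h
    · exact (Comp.sound h).symm
  have h2 : ∀ q q', Joined P q q' → (Quot.mk _ q : s.Component) = Quot.mk _ q' := by
    rintro q q' ⟨b, b', h⟩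
    exact Quot.sound ⟨!b, b', (s.step_iff _ _).2 (.inl (by simpa [opp] using h))⟩
  exact Nat.card_congr
    { toFun := Quot.lift _ h1
      invFun := Quot.lift _ h2
      left_inv := by rintro ⟨q⟩; rfl
      right_inv := by rintro ⟨q⟩; rfl }

end KnotoidDiagram

/-! ### The state sum -/

/-- The value of a circle. -/
noncomputable def loopValue : BracketRing := -LaurentPolynomial.T 2 - LaurentPolynomial.T (-2)

/-- The weight, including its contribution to the writhe, of a splitting which respects the
orientation (`o = true`) or does not, at a positive or negative crossing. -/
noncomputable def splitWeight (p o : Bool) : BracketRing :=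
  if p then -LaurentPolynomial.T (-3) * LaurentPolynomial.T (if o then 1 else -1)
  else -LaurentPolynomial.T 3 * LaurentPolynomial.T (if o then -1 else 1)

theorem loopValue_ne_zero : loopValue ≠ 0 := by
  intro h
  have := congrArg (fun p : BracketRing => (p.coeff 2)) h
  simp [loopValue, LaurentPolynomial.T_apply] at this

theorem uPow_add (a b : ℤ) : uPow (a + b) = uPow a * uPow b := by
  rw [uPow, LaurentPolynomial.T_add, map_mul, uPow, uPow]

theorem uPow_zero : uPow 0 = 1 := by simp [uPow]

theorem Units.val_zpow_sum {M : Type*} [CommMonoid M] {ι : Type*} (s : Finset ι) (a : Mˣ)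
    (f : ι → ℤ) : ((a ^ (∑ i ∈ s, f i) : Mˣ) : M) = ∏ i ∈ s, ((a ^ f i : Mˣ) : M) := by
  classical
  induction s using Finset.induction_on with
  | empty => simp
  | insert i s hi ih =>
    rw [Finset.sum_insert hi, Finset.prod_insert hi, zpow_add, Units.val_mul, ih]

theorem T_sum {ι : Type*} (s : Finset ι) (f : ι → ℤ) :
    (LaurentPolynomial.T (∑ i ∈ s, f i) : BracketRing) = ∏ i ∈ s, LaurentPolynomial.T (f i) := by
  classical
  induction s using Finset.induction_on with
  | empty => simp
  | insert i s hi ih =>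
    rw [Finset.sum_insert hi, Finset.prod_insert hi, LaurentPolynomial.T_add, ih]

namespace KnotoidDiagram

variable (D : KnotoidDiagram)

noncomputable def stateSum : BracketRing :=
  ∑ o : Fin D.n → Bool, (∏ c, splitWeight (D.positive c) (o c)) *
    eval none loopValue (weight D.stub) (D.Linked fun c => some (o c))

variable {D}

theorem State.orientation_involutive :
    Function.Involutive (State.orientation : D.State → D.State) := by
  intro s
  funext c
  simp only [State.orientation]
  cases s c <;> cases D.positive c <;> rfl

theorem State.prod_splitWeight (s : D.State) :
    (((-cubeUnit) ^ (-D.writhe) : BracketRingˣ) : BracketRing) * LaurentPolynomial.T s.exponent =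
      ∏ c, splitWeight (D.positive c) (s.orientation c) := by
  rw [writhe, State.exponent, T_sum, ← Finset.sum_neg_distrib, Units.val_zpow_sum,
    ← Finset.prod_mul_distrib]
  refine Finset.prod_congr rfl fun c _ => ?_
  have h1 : (((-cubeUnit) ^ (-1 : ℤ) : BracketRingˣ) : BracketRing) = -LaurentPolynomial.T (-3) := by
    rw [zpow_neg_one]
    rfl
  have h2 : (((-cubeUnit) ^ (-(-1) : ℤ) : BracketRingˣ) : BracketRing) = -LaurentPolynomial.T 3 := by
    rw [neg_neg, zpow_one]
    rfl
  cases hp : D.positive c <;> cases hs : s c <;>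
    simp only [splitWeight, State.orientation, hp, hs, if_true, if_false, Bool.false_eq_true, h1,
      h2] <;> rfl

/-- The difference of segment and diagram vanishes on the leg edge and satisfies Kirchhoff's law, so
`sum_cycle` applies. The diagram disappears from the local terms, because each is the coefficient of
an incoming edge minus that of an outgoing one. -/
theorem State.intersection_sub (s : D.State) (α : D.Shortcut) :
    -intersection (fun _ => 1) α + intersection s.segment α = -∑ c, crossingFlow D.stub s.flow c := by
  have h1 : -intersection (fun _ => 1) α + intersection s.segment α =
      (α.crossed.map fun d => (s.segment d.1 - 1) * if d.2 then -1 else 1).sum := by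
    simp only [intersection, sub_mul, one_mul]
    induction α.crossed with
    | nil => simp
    | cons d l ih =>
      simp only [List.map_cons, List.sum_cons] at ih ⊢
      linarith
  have hk := fun c => s.isFlow.kirchhoff c
  have hr := s.isFlow.root
  simp only [State.flow, ArcCode.stub_true, ArcCode.stub_false, if_true, if_false,
    Bool.false_eq_true] at hk hr
  rw [h1, ArcCode.Shortcut.sum_cycle D.isArc D.isSpherical α (fun q => s.segment q - 1)
    (by omega) (fun c => by have := hk c; omega), ← Finset.sum_neg_distrib]
  refine Finset.sum_congr rfl fun c _ => ?_
  simp only [crossingFlow, State.flow, ArcCode.stub_true, ArcCode.stub_false, if_true,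
    if_false, Bool.false_eq_true]
  ring

variable (D)

theorem loopValue_mul_extendedBracketAlong (α : D.Shortcut) :
    loopValue * D.extendedBracketAlong α = D.stateSum := by
  rw [extendedBracketAlong, stateSum, Finset.mul_sum, Finset.mul_sum]
  refine Fintype.sum_equiv State.orientation_involutive.toPerm _ _ fun s => ?_
  rw [Function.Involutive.coe_toPerm, eval_eq s.isFlow, ← s.prod_splitWeight, s.card_component,
    weight, ← s.intersection_sub α, uPow_add]
  have : Finite (Comp (D.Linked fun c => some (s.orientation c))) := Quot.finite _
  have : Nonempty (Comp (D.Linked fun c => some (s.orientation c))) := ⟨Comp.mk _ none⟩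
  -- The component of the leg edge makes the count positive, so the truncated subtraction in the
  -- exponent is a true one.
  obtain ⟨k, hk⟩ : ∃ k, comps (D.Linked fun c => some (s.orientation c)) = k + 1 :=
    Nat.exists_eq_succ_of_ne_zero Nat.card_pos.ne'
  rw [hk, Nat.add_sub_cancel, pow_succ, loopValue]
  ring

theorem extendedBracketAlong_eq (α : D.Shortcut) :
    D.extendedBracketAlong α = D.extendedBracket :=
  mul_left_cancel₀ loopValue_ne_zero
    ((D.loopValue_mul_extendedBracketAlong α).trans
      (D.loopValue_mul_extendedBracketAlong _).symm)

theorem loopValue_mul_extendedBracket : loopValue * D.extendedBracket = D.stateSum :=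
  D.loopValue_mul_extendedBracketAlong _

variable {D}

theorem extendedBracket_congr {D' : KnotoidDiagram} (h : D.stateSum = D'.stateSum) :
    D.extendedBracket = D'.extendedBracket :=
  mul_left_cancel₀ loopValue_ne_zero (by
    rw [loopValue_mul_extendedBracket, loopValue_mul_extendedBracket, h])

end KnotoidDiagram

/-! ### The expansion in powers of `x` -/

theorem substExp_T (n : ℤ) : substExp (LaurentPolynomial.T n) =
    ((expUnit ^ n : (PowerSeries (LaurentPolynomial ℚ))ˣ) : PowerSeries (LaurentPolynomial ℚ)) :=
  LaurentPolynomial.eval₂_T _ _ _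

theorem constantCoeff_substExp_T (n : ℤ) :
    PowerSeries.constantCoeff (substExp (LaurentPolynomial.T n)) = 1 := by
  have h : Units.map (PowerSeries.constantCoeff (R := LaurentPolynomial ℚ)).toMonoidHom expUnit =
      1 := by
    ext1
    exact PowerSeries.constantCoeff_exp
  have := congrArg Units.val (map_zpow (Units.map
    (PowerSeries.constantCoeff (R := LaurentPolynomial ℚ)).toMonoidHom) expUnit n)
  rw [h, one_zpow] at this
  rw [substExp_T]
  exact this

/-- The constant term is -2, which is invertible over the rational numbers. -/
theorem isUnit_substExp_loopValue : IsUnit (substExp loopValue) := by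
  rw [PowerSeries.isUnit_iff_constantCoeff, loopValue, map_sub, map_neg, map_sub, map_neg,
    constantCoeff_substExp_T, constantCoeff_substExp_T]
  have : (-1 - 1 : LaurentPolynomial ℚ) = LaurentPolynomial.C (-2) := by
    rw [map_neg, map_ofNat]
    norm_num
  rw [this]
  exact (isUnit_iff_ne_zero.2 (by norm_num)).map _

/-- At `x = 0`, that is `A = 1`, all splitting weights equal -1. -/
theorem X_dvd_substExp_sub (o : Bool) :
    PowerSeries.X ∣ substExp (splitWeight true o - splitWeight false o) := by
  rw [PowerSeries.X_dvd_iff]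
  simp only [splitWeight, if_true, if_false, Bool.false_eq_true, map_sub, map_mul, map_neg,
    constantCoeff_substExp_T]
  ring

/-- The series of `e ^ (n x)` comes from one over `ℚ`, so its coefficients do not involve `u`. Hence
a bound on the powers of `u` can be chosen independently of `k`. -/
theorem exists_coeff_substExp_T (n : ℤ) : ∃ g : ℕ → ℚ, ∀ k,
    PowerSeries.coeff k (substExp (LaurentPolynomial.T n)) = LaurentPolynomial.C (g k) := by
  let u : (PowerSeries ℚ)ˣ :=
    { val := PowerSeries.exp ℚ
      inv := PowerSeries.evalNegHom (PowerSeries.exp ℚ)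
      val_inv := PowerSeries.exp_mul_exp_neg_eq_one
      inv_val := by
        rw [mul_comm]
        exact PowerSeries.exp_mul_exp_neg_eq_one }
  have h : Units.map (PowerSeries.map (LaurentPolynomial.C (R := ℚ))).toMonoidHom u =
      expUnit := by
    ext1
    exact PowerSeries.map_exp _
  refine ⟨fun k => PowerSeries.coeff k ((u ^ n : (PowerSeries ℚ)ˣ) : PowerSeries ℚ), fun k => ?_⟩
  rw [substExp_T, ← h, ← map_zpow]
  exact PowerSeries.coeff_map _ _ _

/-- The powers of `u` in the coefficients are bounded. -/
theorem exists_bound_coeff_substExp (b : BracketRing) : ∃ N : ℕ, ∀ k (l : ℤ), N < l.natAbs →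
    (PowerSeries.coeff k (substExp b)).coeff l = 0 := by
  induction b using LaurentPolynomial.induction_on' with
  | add p q hp hq =>
    obtain ⟨N, hN⟩ := hp
    obtain ⟨N', hN'⟩ := hq
    refine ⟨max N N', fun k l hl => ?_⟩
    rw [map_add, map_add, AddMonoidAlgebra.coeff_add, Finsupp.add_apply,
      hN k l ((le_max_left _ _).trans_lt hl), hN' k l ((le_max_right _ _).trans_lt hl), add_zero]
  | C_mul_T n a =>
    obtain ⟨g, hg⟩ := exists_coeff_substExp_T n
    refine ⟨a.coeff.support.sup Int.natAbs, fun k l hl => ?_⟩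
    have ha : a.coeff l = 0 := by
      by_contra h
      exact absurd (Finset.le_sup (f := Int.natAbs) (Finsupp.mem_support_iff.2 h)) (not_le.2 hl)
    have hC : substExp (LaurentPolynomial.C a) =
        PowerSeries.C (AddMonoidAlgebra.mapRingHom ℤ (Int.castRingHom ℚ) a) :=
      LaurentPolynomial.eval₂_C _ _ _
    rw [map_mul, hC, PowerSeries.coeff_C_mul, hg, mul_comm, ← LaurentPolynomial.smul_eq_C_mul,
      AddMonoidAlgebra.coeff_smul, Finsupp.smul_apply]
    have : (AddMonoidAlgebra.mapRingHom ℤ (Int.castRingHom ℚ) a).coeff l = (a.coeff l : ℚ) := by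
      simp
    rw [this, ha, Int.cast_zero, smul_zero]

namespace KnotoidDiagram

theorem exists_expansion (D : KnotoidDiagram) : ∃ n₁ m₁ : ℕ, ∀ k : ℕ,
    PowerSeries.coeff k D.extendedBracketSeries =
      ∑ l ∈ Finset.Icc (-(n₁ : ℤ)) (m₁ : ℤ),
        LaurentPolynomial.C (D.bracketCoeff k l) * LaurentPolynomial.T l := by
  obtain ⟨N, hN⟩ := exists_bound_coeff_substExp D.extendedBracket
  refine ⟨N, N, fun k => LaurentPolynomial.ext fun l => ?_⟩
  have h : ∀ m : ℤ, (LaurentPolynomial.C (D.bracketCoeff k m) *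
      LaurentPolynomial.T m : LaurentPolynomial ℚ).coeff l =
      if m = l then D.bracketCoeff k m else 0 := by
    intro m
    rw [← LaurentPolynomial.single_eq_C_mul_T, AddMonoidAlgebra.coeff_single,
      Finsupp.single_apply]
  rw [AddMonoidAlgebra.coeff_sum, Finsupp.finsetSum_apply, Finset.sum_congr rfl fun m _ => h m,
    Finset.sum_ite_eq']
  split_ifs with hl
  · rfl
  · refine hN k l ?_
    rw [Finset.mem_Icc] at hl
    omega

end KnotoidDiagram

/-! ### Alternating sums over the resolutions of singular crossings. -/

namespace SingularKnotoidDiagram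

variable (S : SingularKnotoidDiagram)

theorem extend_map {G H : Type*} [AddCommGroup G] [AddCommGroup H] (φ : G →+ H)
    (v : KnotoidDiagram → G) : S.extend (fun D => φ (v D)) = φ (S.extend v) := by
  simp [extend, map_sum, map_zsmul]

theorem resolve_positive_of_some (ε : S.SingularCrossing → Bool) {c : Fin S.n} {b : Bool}
    (h : S.kind c = some b) : (S.resolve ε).positive c = b := by
  simp only [resolve]
  split <;> simp_all

theorem resolve_positive_of_none (ε : S.SingularCrossing → Bool) (c : S.SingularCrossing) :
    (S.resolve ε).positive c.1 = ε c := by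
  obtain ⟨c, h⟩ := c
  simp only [resolve]
  split <;> simp_all

theorem prod_resolve {R : Type*} [CommRing R] (ε : S.SingularCrossing → Bool)
    (g : Fin S.n → Bool → R) {f : Fin S.n → Bool} (hf : f = (S.resolve ε).positive) :
    ∏ c, g c (f c) = (∏ c : {c // ¬S.kind c = none}, g c ((S.kind c).getD true)) *
      ∏ c : S.SingularCrossing, g c (ε c) := by
  rw [← Fintype.prod_subtype_mul_prod_subtype (fun c => S.kind c = none), mul_comm]
  congr 1
  · refine Finset.prod_congr rfl fun c _ => ?_
    obtain ⟨b, hb⟩ := Option.ne_none_iff_exists'.1 c.2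
    rw [hb, hf, S.resolve_positive_of_some ε hb, Option.getD_some]
  · refine Finset.prod_congr rfl fun c _ => ?_
    rw [hf, S.resolve_positive_of_none]

/-- Expanding the product of the differences `g c true - g c false` yields one signed term for every
resolution. -/
theorem sum_prod_resolve {R : Type*} [CommRing R] (g : Fin S.n → Bool → R) :
    ∑ ε : S.SingularCrossing → Bool, (∏ c, if ε c then (1 : R) else -1) *
      ∏ c : Fin S.n, g c ((S.resolve ε).positive c) =
      (∏ c : {c // ¬S.kind c = none}, g c ((S.kind c).getD true)) *
        ∏ c : S.SingularCrossing, (g c true - g c false) := by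
  have h1 : ∏ c : S.SingularCrossing, (g c true - g c false) =
      ∏ c : S.SingularCrossing, ∑ b : Bool, (if b then (1 : R) else -1) * g c b := by
    refine Finset.prod_congr rfl fun c _ => ?_
    simp only [Fintype.sum_bool, if_true, if_false, Bool.false_eq_true]
    ring
  rw [h1, Finset.prod_univ_sum, Fintype.piFinset_univ, Finset.mul_sum]
  refine Finset.sum_congr rfl fun ε _ => ?_
  rw [S.prod_resolve ε g rfl, Finset.prod_mul_distrib]
  ring

/-- All resolutions share the same curve, and `o` refers to its orientation, not to the crossing
signs. So the `eval` factor is common to all of them and the alternating sum acts on the weights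
only. -/
theorem loopValue_mul_extend : loopValue * S.extend (fun D => D.extendedBracket) =
    ∑ o : Fin S.n → Bool, (∏ c : {c // ¬S.kind c = none},
      splitWeight ((S.kind c).getD true) (o c)) *
      (∏ c : S.SingularCrossing, (splitWeight true (o c) - splitWeight false (o c))) *
      eval none loopValue (weight S.stub) (S.Linked fun c => some (o c)) := by
  have h1 : ∀ ε, loopValue * ((∏ c, if ε c then (1 : ℤ) else -1) • (S.resolve ε).extendedBracket) =
      ∑ o : Fin S.n → Bool, ((∏ c, if ε c then (1 : BracketRing) else -1) *
        ∏ c : Fin S.n, splitWeight ((S.resolve ε).positive c) (o c)) *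
        eval none loopValue (weight S.stub) (S.Linked fun c => some (o c)) := by
    intro ε
    rw [mul_smul_comm, KnotoidDiagram.loopValue_mul_extendedBracket, zsmul_eq_mul,
      KnotoidDiagram.stateSum, Finset.mul_sum]
    refine Finset.sum_congr rfl fun o _ => ?_
    rw [mul_assoc]
    congr 1
    push_cast
    rfl
  rw [extend, Finset.mul_sum, Finset.sum_congr rfl fun ε _ => h1 ε, Finset.sum_comm]
  refine Finset.sum_congr rfl fun o _ => ?_
  rw [← Finset.sum_mul, S.sum_prod_resolve fun c p => splitWeight p (o c)]

theorem X_pow_dvd_extend :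
    PowerSeries.X ^ Fintype.card S.SingularCrossing ∣
      S.extend fun D => D.extendedBracketSeries := by
  rw [← isUnit_substExp_loopValue.dvd_mul_left]
  rw [show (fun D : KnotoidDiagram => D.extendedBracketSeries) =
      fun D => substExp.toAddMonoidHom D.extendedBracket from rfl, S.extend_map]
  change _ ∣ substExp loopValue * substExp _
  rw [← map_mul, loopValue_mul_extend, map_sum]
  refine Finset.dvd_sum fun o _ => ?_
  rw [map_mul, map_mul]
  refine Dvd.dvd.mul_right (Dvd.dvd.mul_left ?_ _) _
  rw [map_prod, Fintype.card, ← Finset.prod_const]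
  exact Finset.prod_dvd_prod_of_dvd _ _ fun c _ => X_dvd_substExp_sub _

theorem coeff_extend_eq_zero {k : ℕ} (hk : k < Fintype.card S.SingularCrossing) :
    S.extend (fun D => PowerSeries.coeff k D.extendedBracketSeries) = 0 := by
  let φ : PowerSeries (LaurentPolynomial ℚ) →+ LaurentPolynomial ℚ :=
    { toFun := fun p => PowerSeries.coeff k p
      map_zero' := map_zero _
      map_add' := fun p q => map_add _ p q }
  have h := S.extend_map φ fun D => D.extendedBracketSeries
  have h' : φ (S.extend fun D => D.extendedBracketSeries) = 0 :=
    PowerSeries.X_pow_dvd_iff.1 S.X_pow_dvd_extend k hk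
  rw [h'] at h
  exact h

theorem bracketCoeff_extend_eq_zero {k : ℕ} (hk : k < Fintype.card S.SingularCrossing) (l : ℤ) :
    S.extend (fun D => D.bracketCoeff k l) = 0 := by
  let φ : LaurentPolynomial ℚ →+ ℚ :=
    { toFun := fun p => p.coeff l
      map_zero' := rfl
      map_add' := fun _ _ => rfl }
  exact (S.extend_map φ fun D => PowerSeries.coeff k D.extendedBracketSeries).trans
    (by rw [S.coeff_extend_eq_zero hk, map_zero])

end SingularKnotoidDiagram

/-! ### Local moves in the state sum -/

theorem T_ofNat_mul_T_neg (k : ℕ) :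
    (LaurentPolynomial.T 1 : BracketRing) ^ k * LaurentPolynomial.T (-1) ^ k = 1 := by
  rw [← mul_pow, ← LaurentPolynomial.T_add]
  simp

theorem loopValue_eq : loopValue =
    -(LaurentPolynomial.T 1) ^ 2 - (LaurentPolynomial.T (-1)) ^ 2 := by
  rw [loopValue, LaurentPolynomial.T_pow, LaurentPolynomial.T_pow]
  norm_num

theorem splitWeight_eq (p o : Bool) : splitWeight p o =
    (if p then -LaurentPolynomial.T (-1) ^ 3 else -LaurentPolynomial.T 1 ^ 3) *
      (if o == p then LaurentPolynomial.T 1 else LaurentPolynomial.T (-1)) := by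
  cases p <;> cases o <;> simp [splitWeight, LaurentPolynomial.T_pow]

/-- The identity of the first Reidemeister move: at a kink, the splitting that respects the
orientation cuts off a circle. -/
theorem splitWeight_loop (p : Bool) :
    splitWeight p true * loopValue + splitWeight p false = 1 := by
  have h := T_ofNat_mul_T_neg 1
  rw [pow_one, pow_one] at h
  rw [splitWeight_eq, splitWeight_eq, loopValue_eq]
  set A : BracketRing := LaurentPolynomial.T 1
  set B : BracketRing := LaurentPolynomial.T (-1)
  cases p
  · simp only [if_false, Bool.false_eq_true, beq_self_eq_true, Bool.true_eq_false, beq_iff_eq,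
      if_true]
    linear_combination (1 + A * B + A ^ 2 * B ^ 2 + A ^ 4) * h
  · simp only [if_true, if_false, beq_self_eq_true, Bool.false_eq_true, beq_iff_eq]
    linear_combination (1 + A * B + A ^ 2 * B ^ 2 + B ^ 4) * h

/-- The writhe factors of two crossings of opposite sign cancel. -/
theorem splitWeight_mul_splitWeight_not (p k l : Bool) : splitWeight p k * splitWeight (!p) l =
    (if k == p then LaurentPolynomial.T 1 else LaurentPolynomial.T (-1)) *
      (if l == !p then LaurentPolynomial.T 1 else LaurentPolynomial.T (-1)) := by
  have h := T_ofNat_mul_T_neg 3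
  rw [splitWeight_eq, splitWeight_eq]
  cases p
  · simp only [if_false, Bool.false_eq_true, Bool.not_false, if_true]
    linear_combination (if k == false then LaurentPolynomial.T 1 else LaurentPolynomial.T (-1)) *
      (if l == true then LaurentPolynomial.T 1 else LaurentPolynomial.T (-1)) * h
  · simp only [if_false, Bool.false_eq_true, Bool.not_true, if_true]
    linear_combination (if k == true then LaurentPolynomial.T 1 else LaurentPolynomial.T (-1)) *
      (if l == false then LaurentPolynomial.T 1 else LaurentPolynomial.T (-1)) * h

theorem sum_bool_beq {R : Type*} [AddCommMonoid R] (F : Bool → R) (m : Bool) :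
    ∑ b, F b = ∑ b, F (b == m) := by
  cases m <;> simp [add_comm]

/-- Every function is hit twice on the right. This isolates the splittings at one crossing without
changing the index set; the powers of 2 are cancelled at the end. -/
theorem two_mul_sum_eq_sum_update {ι R : Type*} [Fintype ι] [DecidableEq ι] [CommRing R]
    (H : (ι → Bool) → R) (x : ι) : 2 * ∑ o, H o = ∑ o, ∑ b, H (Function.update o x b) := by
  have flip : Function.Involutive fun o : ι → Bool => Function.update o x (!o x) := by
    intro o
    simp
  have h1 : ∑ o, H (Function.update o x (!o x)) = ∑ o, H o :=
    Fintype.sum_equiv flip.toPerm _ _ fun o => rfl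
  have h2 : ∀ o : ι → Bool, ∑ b, H (Function.update o x b) =
      H o + H (Function.update o x (!o x)) := by
    intro o
    rw [Fintype.sum_bool]
    conv_rhs => enter [1]; rw [← Function.update_eq_self x o]
    cases o x
    · exact add_comm _ _
    · rfl
  rw [Finset.sum_congr rfl fun o _ => h2 o, Finset.sum_add_distrib, h1, two_mul]

/-! ### Sums over the splittings at a kink and at a bigon. -/

namespace Wiring

theorem SamePairs.append {E : Type} {L₁ L₂ L₁' L₂' : List ((E × Bool) × (E × Bool))}
    (h₁ : SamePairs L₁ L₁') (h₂ : SamePairs L₂ L₂') : SamePairs (L₁ ++ L₂) (L₁' ++ L₂') := by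
  constructor
  · intro p hp
    rcases List.mem_append.1 hp with hp | hp
    · rcases h₁.1 p hp with h | h | h <;> simp [h]
    · rcases h₂.1 p hp with h | h | h <;> simp [h]
  · intro p hp
    rcases List.mem_append.1 hp with hp | hp
    · rcases h₁.2 p hp with h | h | h <;> simp [h]
    · rcases h₂.2 p hp with h | h | h <;> simp [h]

section

variable {ι E : Type} {st : Bool → ι × Bool → E × Bool} {r : E}

/-- Different passages have different ends, and the root is not the end of a passage. -/
structure IsStub (st : Bool → ι × Bool → E × Bool) (r : E) : Prop where
  inj : ∀ {b p b' p'}, st b p = st b' p' → b = b' ∧ p = p'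
  ne_root : ∀ b p, st b p ≠ (r, true)

/-- By `hin` the edge runs from one passage to another, and by injectivity its two ends belong to no
further passage. -/
theorem IsStub.fst_ne (h : IsStub st r) {b b₀ b₁ : Bool} {p p₀ p₁ : ι × Bool}
    (hin : opp (st b₀ p₀) = st b₁ p₁) (h₀ : ¬(b = b₀ ∧ p = p₀)) (h₁ : ¬(b = b₁ ∧ p = p₁)) :
    (st b p).1 ≠ (st b₀ p₀).1 := by
  intro hh
  rcases eq_or_eq_opp hh with hh | hh
  · exact h₀ (h.inj hh)
  · exact h₁ (h.inj (hh.trans hin))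

theorem IsStub.fst_ne_root (h : IsStub st r) {b₀ b₁ : Bool} {p₀ p₁ : ι × Bool}
    (hin : opp (st b₀ p₀) = st b₁ p₁) : (st b₀ p₀).1 ≠ r := by
  intro hh
  rcases eq_or_eq_opp (d := (r, true)) (d' := st b₀ p₀) hh.symm with hh | hh
  · exact h.ne_root _ _ hh.symm
  · exact h.ne_root _ _ (hin ▸ hh).symm

theorem IsStub.inner {R : Type*} (h : IsStub st r) {S : Finset ι} {κ : ι → Option Bool}
    {U : (E × Bool → ℤ) → R} {b₀ b₁ : Bool} {p₀ p₁ : ι × Bool}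
    (hin : opp (st b₀ p₀) = st b₁ p₁) (h₀ : p₀.1 ∈ S) (h₁ : p₁.1 ∈ S)
    (hU : ∀ W W', (∀ d, d.1 ≠ (st b₀ p₀).1 → W d = W' d) → U W = U W') :
    Inner r U (LinkedOff st S κ) (st b₀ p₀) := by
  refine ⟨h.fst_ne_root hin, ?_, hU⟩
  rintro d d' ⟨c, hc, hd⟩
  obtain ⟨b, e, b', e', rfl, rfl⟩ := exists_stub_of_mem_pairs hd
  constructor <;> refine h.fst_ne hin ?_ ?_ <;> rintro ⟨-, rfl⟩ <;> exact hc ‹_›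

theorem linked_eq_add {S : Finset ι} {κ κ₀ : ι → Option Bool} (hκ : ∀ x ∉ S, κ x = κ₀ x)
    {L : List ((E × Bool) × (E × Bool))} (hL : ∀ p, p ∈ L ↔ ∃ x ∈ S, p ∈ pairs st (κ x) x) :
    Linked st κ = add (LinkedOff st S κ₀) L := by
  funext d d'
  refine propext ⟨?_, ?_⟩
  · rintro ⟨x, hx⟩
    by_cases hxS : x ∈ S
    · exact .inr ((hL _).2 ⟨x, hxS, hx⟩)
    · exact .inl ⟨x, hxS, by rwa [← hκ x hxS]⟩
  · rintro (⟨x, hxS, hx⟩ | h)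
    · exact ⟨x, by rwa [hκ x hxS]⟩
    · obtain ⟨x, -, hx⟩ := (hL _).1 h
      exact ⟨x, hx⟩

/-- Joining two neighbouring ends respects the orientation if and only if one is incoming and the
other outgoing, that is `a != b`. This translates orientation flags into flags of `corner`. -/
theorem samePairs_corner (st : Bool → ι × Bool → E × Bool) (s a b e : Bool) (c : ι) :
    SamePairs (pairs st (some (s == (a != b))) c)
      (corner s (st a (c, e)) (st b (c, !e)) (st (!a) (c, e)) (st (!b) (c, !e))) := by
  cases s <;> cases a <;> cases b <;> cases e <;> simp [SamePairs, pairs, corner]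

variable [Fintype ι] [DecidableEq ι]

/-- The contribution of the double points outside `S` to the weight. -/
noncomputable def weightOff (st : Bool → ι × Bool → E × Bool) (S : Finset ι)
    (W : E × Bool → ℤ) : BracketRing :=
  uPow (-∑ c ∈ Sᶜ, crossingFlow st W c)

theorem weight_eq (S : Finset ι) (W : E × Bool → ℤ) :
    weight st W = weightOff st S W * uPow (-∑ c ∈ S, crossingFlow st W c) := by
  rw [weight, weightOff, ← uPow_add, ← Finset.sum_compl_add_sum S, neg_add]

theorem IsStub.weightOff_congr (h : IsStub st r) {S : Finset ι} {b₀ b₁ : Bool}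
    {p₀ p₁ : ι × Bool} (hin : opp (st b₀ p₀) = st b₁ p₁) (h₀ : p₀.1 ∈ S) (h₁ : p₁.1 ∈ S)
    {W W' : E × Bool → ℤ} (hW : ∀ d, d.1 ≠ (st b₀ p₀).1 → W d = W' d) :
    weightOff st S W = weightOff st S W' := by
  have key : ∀ c ∈ Sᶜ, ∀ b e, W (st b (c, e)) = W' (st b (c, e)) := by
    intro c hc b e
    rw [Finset.mem_compl] at hc
    exact hW _ (h.fst_ne hin (by rintro ⟨-, rfl⟩; exact hc h₀) (by rintro ⟨-, rfl⟩; exact hc h₁))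
  rw [weightOff, weightOff, Finset.sum_congr rfl fun c hc => by
    rw [crossingFlow, key c hc, key c hc, ← crossingFlow]]

/-- The double points in `S` are erased, and the others are split. -/
def erased (S : Finset ι) (o : ι → Bool) (x : ι) : Option Bool :=
  if x ∈ S then none else some (o x)

/-- The state sum of a wiring with signs at the double points. -/
noncomputable def stateSum (r : E) (st : Bool → ι × Bool → E × Bool) (pos : ι → Bool) :
    BracketRing :=
  ∑ o : ι → Bool, (∏ c, splitWeight (pos c) (o c)) *
    eval r loopValue (weight st) (Linked st fun c => some (o c))

variable [Finite E]

/-- Up to a factor `loopValue`, both splittings and the unsplit kink reduce to the same pairing `X`.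
Only the splitting that respects the orientation has an extra circle, and `splitWeight_loop`
finishes. -/
theorem sum_monogon (h : IsStub st r) {c : ι} {e : Bool}
    (hin : opp (st false (c, e)) = st true (c, !e)) (p : Bool) (o : ι → Bool) :
    ∑ b : Bool, splitWeight p b *
      eval r loopValue (weight st) (Linked st fun x => some (Function.update o c b x)) =
    eval r loopValue (weightOff st {c}) (Linked st (erased {c} o)) := by
  set P₀ := LinkedOff st {c} fun x => some (o x) with hP₀
  have hw : ∀ κ W, IsFlow (Linked st κ) r W → weight st W = weightOff st {c} W := by
    intro κ W hW
    have h1 := hW.kirchhoff c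
    have h2 := hW.opp (st false (c, e))
    rw [hin] at h2
    -- Opposite ends of the loop cancel in Kirchhoff's law, so the kink does not contribute to the
    -- exponent of `u`.
    have h3 : crossingFlow st W c = 0 := by
      rw [crossingFlow]
      cases e <;> simp only [Bool.not_true, Bool.not_false] at h2 <;> omega
    rw [weight_eq {c}, Finset.sum_singleton, h3, neg_zero, uPow_zero, mul_one]
  have hb : ∀ b, eval r loopValue (weight st) (Linked st fun x => some (Function.update o c b x)) =
      eval r loopValue (weightOff st {c}) (add P₀ (pairs st (some b) c)) := by
    intro b
    rw [eval_congr_weight (hw _), linked_eq_add (S := {c}) (κ₀ := fun x => some (o x))]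
    · intro x hx
      rw [Finset.mem_singleton] at hx
      rw [Function.update_of_ne hx]
    · simp
  have ht : Linked st (erased {c} o) = add P₀ (pairs st none c) := by
    refine linked_eq_add (fun x hx => if_neg hx) ?_
    simp
  have hi : Inner r (weightOff st {c}) P₀ (st false (c, e)) :=
    h.inner hin (by simp) (by simp) fun W W' => h.weightOff_congr hin (by simp) (by simp)
  set X := eval r loopValue (weightOff st {c}) (add P₀ [(st true (c, e), st false (c, !e))])
  have na : (st true (c, e)).1 ≠ (st false (c, e)).1 := h.fst_ne hin (by simp) (by simp)
  have nb : (st false (c, !e)).1 ≠ (st false (c, e)).1 := h.fst_ne hin (by simp) (by simp)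
  have h1 : eval r loopValue (weightOff st {c}) (add P₀ (pairs st (some true) c)) = X := by
    refine eval_add_congr _ _ _ _ ?_
    cases e <;> simp at hin <;> simp [SamePairs, pairs, ← hin]
  have h2 : loopValue *
      eval r loopValue (weightOff st {c}) (add P₀ (pairs st (some false) c)) = X := by
    refine hi.contract loopValue [] (st false (c, !e)) (st true (c, e)) ?_ ?_ ?_
    · cases e <;> simp at hin <;> simp [SamePairs, pairs, ← hin]
    · simp [SamePairs]
    · simp [na, nb]
  have h3 : loopValue * eval r loopValue (weightOff st {c}) (add P₀ (pairs st none c)) = X := by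
    refine hi.contract loopValue [] (st true (c, e)) (st false (c, !e)) ?_ ?_ ?_
    · cases e <;> simp at hin <;> simp [SamePairs, pairs, ← hin]
    · simp [SamePairs]
    · simp [na, nb]
  apply mul_left_cancel₀ loopValue_ne_zero
  rw [Fintype.sum_bool, hb, hb, ht, h3, h1]
  linear_combination splitWeight p false * h2 + X * splitWeight_loop p

theorem sum_bigon (h : IsStub st r) {c d : ι} {p b : Bool} (hcd : c ≠ d)
    (ho : opp (st false (c, p)) = st true (d, !p))
    (hu : opp (st (!b) (c, !p)) = st b (d, p)) (o : ι → Bool) :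
    ∑ k : Bool, ∑ l : Bool, splitWeight p k * splitWeight (!p) l *
      eval r loopValue (weight st)
        (Linked st fun x => some (Function.update (Function.update o c k) d l x)) =
    eval r loopValue (weightOff st {c, d}) (Linked st (erased {c, d} o)) := by
  set P₀ := LinkedOff st {c, d} fun x => some (o x) with hP₀
  -- The joint contribution of `c` and `d` to the exponent, rewritten in terms of outer ends, so
  -- that the edges to be contracted do not matter for the weight. It need not vanish for each
  -- splitting if the strands are parallel.
  let F : (E × Bool → ℤ) → ℤ := fun W => if b then
    (if p then W (st true (c, p)) + W (st false (d, !p)) else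
      W (st b (c, !p)) + W (st (!b) (d, p))) else 0
  let V : (E × Bool → ℤ) → BracketRing := fun W => weightOff st {c, d} W * uPow (-F W)
  have hw : ∀ κ W, IsFlow (Linked st κ) r W → weight st W = V W := by
    intro κ W hW
    have h1 := hW.kirchhoff c
    have h2 := hW.kirchhoff d
    have h3 := hW.opp (st false (c, p))
    have h4 := hW.opp (st (!b) (c, !p))
    rw [ho] at h3
    rw [hu] at h4
    have : ∑ x ∈ {c, d}, crossingFlow st W x = F W := by
      rw [Finset.sum_pair hcd, crossingFlow, crossingFlow]
      cases b <;> cases p <;> simp only [Bool.not_true, Bool.not_false, F, if_true, if_false,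
        Bool.false_eq_true] at h3 h4 ⊢ <;> omega
    rw [weight_eq {c, d}, this]
  have hmem : ∀ (k l : Option Bool) (κ : ι → Option Bool), κ c = k → κ d = l → ∀ q,
      q ∈ pairs st k c ++ pairs st l d ↔ ∃ x ∈ ({c, d} : Finset ι), q ∈ pairs st (κ x) x := by
    rintro k l κ rfl rfl q
    simp
  have hkl : ∀ k l, eval r loopValue (weight st)
      (Linked st fun x => some (Function.update (Function.update o c k) d l x)) =
      eval r loopValue V (add P₀ (pairs st (some k) c ++ pairs st (some l) d)) := by
    intro k l
    rw [eval_congr_weight (hw _), linked_eq_add (S := {c, d}) (κ₀ := fun x => some (o x))]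
    · intro x hx
      simp only [Finset.mem_insert, Finset.mem_singleton, not_or] at hx
      rw [Function.update_of_ne hx.2, Function.update_of_ne hx.1]
    · exact hmem _ _ _ (by simp [hcd]) (by simp)
  have ht : eval r loopValue (weightOff st {c, d}) (Linked st (erased {c, d} o)) =
      eval r loopValue V (add P₀ (pairs st none c ++ pairs st none d)) := by
    have hthrough : Linked st (erased {c, d} o) = add P₀ (pairs st none c ++ pairs st none d) :=
      linked_eq_add (fun x hx => if_neg hx) (hmem _ _ _ (if_pos (by simp)) (if_pos (by simp)))
    rw [← hthrough]
    -- For strands that pass straight through, the flow at the outer ends cancels and `F` vanishes.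
    refine eval_congr_weight fun W hW => ?_
    have key : ∀ x ∈ ({c, d} : Finset ι), ∀ e, W (st true (x, e)) = -W (st false (x, e)) := by
      intro x hx e
      exact hW.pair _ _ ⟨x, by rw [erased, if_pos hx]; cases e <;> simp [pairs]⟩
    have k1 := key c (by simp) p
    have k2 := key d (by simp) p
    have k3 := key c (by simp) (!p)
    have k4 := key d (by simp) (!p)
    have h3 := hW.opp (st false (c, p))
    have h4 := hW.opp (st (!b) (c, !p))
    rw [ho] at h3
    rw [hu] at h4
    have : F W = 0 := by
      cases b <;> cases p <;> simp only [Bool.not_true, Bool.not_false, F, if_true, if_false,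
        Bool.false_eq_true] at k1 k2 k3 k4 h3 h4 ⊢ <;> omega
    simp only [V, this, neg_zero, uPow_zero, mul_one]
  have hdc := hcd.symm
  have hio : Inner r V P₀ (st false (c, p)) := by
    refine h.inner ho (by simp) (by simp) fun W W' hW => ?_
    have e1 : ∀ {b' x}, ¬(b' = false ∧ x = (c, p)) → ¬(b' = true ∧ x = (d, !p)) →
      W (st b' x) = W' (st b' x) := fun h1 h2 => hW _ (h.fst_ne ho h1 h2)
    have e2 : F W = F W' := by
      simp only [F]
      rw [e1, e1, e1, e1] <;> cases p <;> simp [hcd, hdc]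
    simp only [V, e2, h.weightOff_congr ho (S := {c, d}) (by simp) (by simp) hW]
  have hiu : Inner r V P₀ (st (!b) (c, !p)) := by
    refine h.inner hu (by simp) (by simp) fun W W' hW => ?_
    have e1 : ∀ {b' x}, ¬(b' = (!b) ∧ x = (c, !p)) → ¬(b' = b ∧ x = (d, p)) →
      W (st b' x) = W' (st b' x) := fun h1 h2 => hW _ (h.fst_ne hu h1 h2)
    have e2 : F W = F W' := by
      simp only [F]
      rw [e1, e1, e1, e1] <;> cases p <;> cases b <;> simp [hcd, hdc]
    simp only [V, e2, h.weightOff_congr hu (S := {c, d}) (by simp) (by simp) hW]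
  have hαβ : (if b == p then LaurentPolynomial.T 1 else LaurentPolynomial.T (-1)) *
      (if b == p then LaurentPolynomial.T (-1) else LaurentPolynomial.T 1) =
      (1 : BracketRing) := by
    split_ifs <;> rw [← LaurentPolynomial.T_add] <;> simp
  have hδ : loopValue =
      -(if b == p then LaurentPolynomial.T 1 else LaurentPolynomial.T (-1) : BracketRing) ^ 2 -
        (if b == p then LaurentPolynomial.T (-1) else LaurentPolynomial.T 1) ^ 2 := by
    rw [loopValue_eq]
    split_ifs <;> ring
  have main := eval_bigon (a := st true (c, p)) (a' := st b (c, !p)) (b := st false (d, !p))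
    (b' := st (!b) (d, p)) hio hiu hαβ hδ loopValue_ne_zero
    (h.fst_ne hu (by simp) (by simp [hcd]))
    (by
      intro x hx
      simp only [List.mem_cons, List.not_mem_nil, or_false] at hx
      rcases hx with rfl | rfl | rfl | rfl <;>
        refine ⟨h.fst_ne ho ?_ ?_, h.fst_ne hu ?_ ?_⟩ <;> cases p <;> cases b <;>
        simp [hcd, hdc])
  rw [ht, eval_add_congr r loopValue V P₀ (L' := [(st true (c, p), st false (c, p)),
    (opp (st false (c, p)), st false (d, !p)), (st b (c, !p), st (!b) (c, !p)),
    (opp (st (!b) (c, !p)), st (!b) (d, p))])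
    (by rw [ho, hu]; cases p <;> cases b <;> simp [SamePairs, pairs]), ← main,
    sum_bool_beq _ (!b)]
  refine Finset.sum_congr rfl fun s _ => ?_
  rw [sum_bool_beq _ (!b)]
  refine Finset.sum_congr rfl fun t _ => ?_
  rw [hkl]
  refine congrArg₂ (· * ·) ?_ ?_
  · rw [splitWeight_mul_splitWeight_not]
    refine congrArg₂ (· * ·) ?_ ?_
    · cases s <;> cases b <;> cases p <;> rfl
    · cases t <;> cases b <;> cases p <;> rfl
  · refine eval_add_congr _ _ _ _ ?_
    have s1 := samePairs_corner st s true b p c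
    have s2 := samePairs_corner st t false (!b) (!p) d
    rw [ho, hu]
    simp only [Bool.not_true, Bool.not_false, Bool.not_not, Bool.true_bne, Bool.false_bne] at s1 s2
    exact s1.append s2

end

end Wiring

/-! ### Weights and splittings at a triangle. -/

namespace Wiring

/-- The contribution of the corners of a triangle to the intersection number, in terms of the flow
through the six outer ends. -/
def triangleFlow (a b p q : Bool) (w₁ w₂ w₃ w₄ w₅ w₆ : ℤ) : ℤ :=
  (if b = p then w₅ + w₆ else w₂ + w₃) + (if a = p then w₁ + w₆ else w₄ + w₃) +
    (if a = q then w₁ + w₂ else w₄ + w₅)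

/-- The third Reidemeister move reverses the order of the passages on each strand, which negates the
directions and turns the six outer ends by a half turn. Hence the exponent of `u` agrees before and
after the move. -/
theorem triangleFlow_not (a b p q : Bool) (w₁ w₂ w₃ w₄ w₅ w₆ : ℤ) :
    triangleFlow (!a) (!b) p q w₄ w₅ w₆ w₁ w₂ w₃ = triangleFlow a b p q w₁ w₂ w₃ w₄ w₅ w₆ := by
  cases a <;> cases b <;> cases p <;> cases q <;> simp [triangleFlow]

variable {ι E : Type} {st : Bool → ι × Bool → E × Bool} {r : E} [Fintype ι] [DecidableEq ι]

/-- The weight for the sum over the corners of a triangle. -/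
noncomputable def triangleWeight (st : Bool → ι × Bool → E × Bool) (S : Finset ι)
    (a b p q : Bool) (p₁ p₂ p₃ p₄ p₅ p₆ : E × Bool) (W : E × Bool → ℤ) : BracketRing :=
  weightOff st S W * uPow (-triangleFlow a b p q (W p₁) (W p₂) (W p₃) (W p₄) (W p₅) (W p₆))

/-- The strands `T`, `M`, `B` form a triangle with corners `x`, `y`, `z` of signs `p`, `q`, `s`. -/
structure TriangleMove (st : Bool → ι × Bool → E × Bool) (x y z : ι) (p q s a b c : Bool) :
    Prop where
  ne₁₂ : x ≠ y
  ne₁₃ : x ≠ z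
  ne₂₃ : y ≠ z
  top : opp (st (!a) (x, p)) = st a (y, q)
  mid : opp (st b (z, s)) = st (!b) (x, !p)
  bot : opp (st (!c) (y, !q)) = st c (z, !s)
  sign₁₂ : p = q ↔ b = c
  sign₁₃ : p = s ↔ a = c

variable {x y z : ι} {p q s a b c : Bool}

/-- The sign conditions determine `q` and `s` from `p` and the directions. Kirchhoff's law at the
three corners and antisymmetry along the sides then eliminate the inner flows. -/
theorem TriangleMove.weight_eq (h : TriangleMove st x y z p q s a b c)
    {κ : ι → Option Bool} {W : E × Bool → ℤ} (hW : IsFlow (Linked st κ) r W) :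
    weight st W = triangleWeight st {x, y, z} a b p q (st a (x, p)) (st b (x, !p))
      (st c (y, !q)) (st (!a) (y, q)) (st (!b) (z, s)) (st (!c) (z, !s)) W := by
  have h1 := hW.kirchhoff x
  have h2 := hW.kirchhoff y
  have h3 := hW.kirchhoff z
  have h4 := hW.opp (st (!a) (x, p))
  have h5 := hW.opp (st b (z, s))
  have h6 := hW.opp (st (!c) (y, !q))
  rw [h.top] at h4
  rw [h.mid] at h5
  rw [h.bot] at h6
  have hq : q = (p == (b == c)) := by
    have := h.sign₁₂
    revert this
    cases p <;> cases q <;> cases b <;> cases c <;> simp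
  have hs : s = (p == (a == c)) := by
    have := h.sign₁₃
    revert this
    cases p <;> cases s <;> cases a <;> cases c <;> simp
  have key : ∑ v ∈ {x, y, z}, crossingFlow st W v = triangleFlow a b p q (W (st a (x, p)))
      (W (st b (x, !p))) (W (st c (y, !q))) (W (st (!a) (y, q))) (W (st (!b) (z, s)))
      (W (st (!c) (z, !s))) := by
    rw [Finset.sum_insert (by simp [h.ne₁₂, h.ne₁₃]), Finset.sum_pair h.ne₂₃]
    simp only [crossingFlow]
    clear h hW
    subst hq hs
    cases a <;> cases b <;> cases c <;> cases p <;>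
      simp [triangleFlow] at h4 h5 h6 ⊢ <;> omega
  rw [Wiring.weight_eq {x, y, z}, key, triangleWeight]

theorem TriangleMove.isTriangle (h : TriangleMove st x y z p q s a b c) (hs : IsStub st r)
    (κ : ι → Option Bool) :
    IsTriangle r (triangleWeight st {x, y, z} a b p q (st a (x, p)) (st b (x, !p))
      (st c (y, !q)) (st (!a) (y, q)) (st (!b) (z, s)) (st (!c) (z, !s)))
      (LinkedOff st {x, y, z} κ) (st a (x, p)) (st b (x, !p))
      (st c (y, !q)) (st (!a) (y, q)) (st (!b) (z, s)) (st (!c) (z, !s))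
      (st (!a) (x, p)) (st (!c) (y, !q)) (st b (z, s)) := by
  have n1 := h.ne₁₂
  have n2 := h.ne₁₃
  have n3 := h.ne₂₃
  have n4 := h.ne₁₂.symm
  have n5 := h.ne₁₃.symm
  have n6 := h.ne₂₃.symm
  have outer : ∀ d ∈ [st a (x, p), st b (x, !p), st c (y, !q), st (!a) (y, q), st (!b) (z, s),
      st (!c) (z, !s)], d.1 ≠ (st (!a) (x, p)).1 ∧ d.1 ≠ (st (!c) (y, !q)).1 ∧
        d.1 ≠ (st b (z, s)).1 := by
    intro d hd
    simp only [List.mem_cons, List.not_mem_nil, or_false] at hd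
    rcases hd with rfl | rfl | rfl | rfl | rfl | rfl <;>
      refine ⟨hs.fst_ne h.top ?_ ?_, hs.fst_ne h.bot ?_ ?_, hs.fst_ne h.mid ?_ ?_⟩ <;>
      simp [n1, n2, n3, n4, n5, n6]
  have ho := outer
  simp only [List.mem_cons, List.not_mem_nil, or_false, forall_eq_or_imp, forall_eq] at ho
  obtain ⟨o1, o2, o3, o4, o5, o6⟩ := ho
  refine ⟨hs.inner h.top (by simp) (by simp) fun W W' hW => ?_,
    hs.inner h.bot (by simp) (by simp) fun W W' hW => ?_,
    hs.inner h.mid (by simp) (by simp) fun W W' hW => ?_,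
    hs.fst_ne h.bot (by simp [n1]) (by simp [n2]), hs.fst_ne h.mid (by simp [n3]) (by simp [n4]),
    hs.fst_ne h.top (by simp [n5]) (by simp [n6]), outer⟩
  · rw [triangleWeight, triangleWeight, hW _ o1.1, hW _ o2.1, hW _ o3.1, hW _ o4.1, hW _ o5.1,
      hW _ o6.1, hs.weightOff_congr h.top (by simp) (by simp) hW]
  · rw [triangleWeight, triangleWeight, hW _ o1.2.1, hW _ o2.2.1, hW _ o3.2.1, hW _ o4.2.1,
      hW _ o5.2.1, hW _ o6.2.1, hs.weightOff_congr h.bot (by simp) (by simp) hW]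
  · rw [triangleWeight, triangleWeight, hW _ o1.2.2, hW _ o2.2.2, hW _ o3.2.2, hW _ o4.2.2,
      hW _ o5.2.2, hW _ o6.2.2, hs.weightOff_congr h.mid (by simp) (by simp) hW]

/-- The writhe factor of a crossing. -/
noncomputable def writheFactor (p : Bool) : BracketRing :=
  if p then -LaurentPolynomial.T (-1) ^ 3 else -LaurentPolynomial.T 1 ^ 3

/-- The sign conditions ensure that cutting off the corners at `x` and `z` has one power of `A` as
its weight, and cutting off the corner at `y` the inverse power. This is the pattern of
`triangleSum`. -/
theorem TriangleMove.sum_eq (h : TriangleMove st x y z p q s a b c)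
    (o : ι → Bool) :
    ∑ k : Bool, ∑ l : Bool, ∑ m : Bool,
      splitWeight p k * splitWeight q l * splitWeight s m * eval r loopValue (weight st)
        (Linked st fun v => some
          (Function.update (Function.update (Function.update o x k) y l) z m v)) =
    writheFactor p * writheFactor q * writheFactor s *
      triangleSum r (triangleWeight st {x, y, z} a b p q (st a (x, p)) (st b (x, !p))
        (st c (y, !q)) (st (!a) (y, q)) (st (!b) (z, s)) (st (!c) (z, !s)))
      (LinkedOff st {x, y, z} fun v => some (o v))
      (if p == (a == b) then LaurentPolynomial.T 1 else LaurentPolynomial.T (-1))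
      (if p == (a == b) then LaurentPolynomial.T (-1) else LaurentPolynomial.T 1) loopValue
      (st a (x, p)) (st b (x, !p)) (st c (y, !q)) (st (!a) (y, q)) (st (!b) (z, s))
      (st (!c) (z, !s)) (st (!a) (x, p)) (st (!c) (y, !q)) (st b (z, s)) := by
  have hmem : ∀ (κ : ι → Option Bool) (d : (E × Bool) × E × Bool),
      d ∈ pairs st (κ x) x ++ pairs st (κ y) y ++ pairs st (κ z) z ↔
        ∃ v ∈ ({x, y, z} : Finset ι), d ∈ pairs st (κ v) v := by
    intro κ d
    simp
  have hklm : ∀ k l m, Linked st (fun v => some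
      (Function.update (Function.update (Function.update o x k) y l) z m v)) =
      add (LinkedOff st {x, y, z} fun v => some (o v))
        (pairs st (some k) x ++ pairs st (some l) y ++ pairs st (some m) z) := by
    intro k l m
    refine linked_eq_add (fun v hv => ?_) fun d => ?_
    · simp only [Finset.mem_insert, Finset.mem_singleton, not_or] at hv
      rw [Function.update_of_ne hv.2.2, Function.update_of_ne hv.2.1, Function.update_of_ne hv.1]
    · rw [← hmem]
      simp [h.ne₁₂, h.ne₁₃, h.ne₂₃]
  rw [triangleSum, Finset.mul_sum, sum_bool_beq _ (a != b)]
  refine Finset.sum_congr rfl fun k _ => ?_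
  rw [Finset.mul_sum, sum_bool_beq _ (c != !a)]
  refine Finset.sum_congr rfl fun l _ => ?_
  rw [Finset.mul_sum, sum_bool_beq _ ((!b) != (!c))]
  refine Finset.sum_congr rfl fun m _ => ?_
  rw [eval_congr_weight fun W => h.weight_eq, hklm]
  have e1 := ((samePairs_corner st k a b p x).append (samePairs_corner st l c (!a) (!q) y)).append
    (samePairs_corner st m (!b) (!c) s z)
  rw [eval_add_congr _ _ _ _ e1]
  have hu : st a (y, q) = opp (st (!a) (x, p)) := h.top.symm
  have hv : st c (z, !s) = opp (st (!c) (y, !q)) := h.bot.symm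
  have hw : st (!b) (x, !p) = opp (st b (z, s)) := h.mid.symm
  simp only [Bool.not_not, hu, hv, hw, triangle]
  rw [splitWeight_eq, splitWeight_eq, splitWeight_eq]
  have hk : (if (k == (a != b)) == p then LaurentPolynomial.T 1 else LaurentPolynomial.T (-1) :
      BracketRing) = if k then
      (if p == (a == b) then LaurentPolynomial.T (-1) else LaurentPolynomial.T 1) else
      (if p == (a == b) then LaurentPolynomial.T 1 else LaurentPolynomial.T (-1)) := by
    cases k <;> cases a <;> cases b <;> cases p <;> rfl
  have hl : (if (l == (c != !a)) == q then LaurentPolynomial.T 1 else LaurentPolynomial.T (-1) :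
      BracketRing) = if l then
      (if p == (a == b) then LaurentPolynomial.T 1 else LaurentPolynomial.T (-1)) else
      (if p == (a == b) then LaurentPolynomial.T (-1) else LaurentPolynomial.T 1) := by
    have := h.sign₁₂
    revert this
    cases l <;> cases a <;> cases b <;> cases c <;> cases p <;> cases q <;> simp
  have hm : (if (m == ((!b) != (!c))) == s then LaurentPolynomial.T 1 else LaurentPolynomial.T (-1) :
      BracketRing) = if m then
      (if p == (a == b) then LaurentPolynomial.T (-1) else LaurentPolynomial.T 1) else
      (if p == (a == b) then LaurentPolynomial.T 1 else LaurentPolynomial.T (-1)) := by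
    have := h.sign₁₃
    revert this
    cases m <;> cases a <;> cases b <;> cases c <;> cases p <;> cases s <;> simp
  rw [hk, hl, hm]
  simp only [writheFactor]
  ring

end Wiring

/-! ### State sums with a few crossings singled out. -/

namespace Wiring

variable {ι E : Type} {st : Bool → ι × Bool → E × Bool} {r : E} [Fintype ι] [DecidableEq ι]

theorem prod_eq_of_eqOn {R : Type*} [CommRing R] (S : Finset ι) {g g' : ι → R}
    (h : ∀ x ∉ S, g x = g' x) : ∏ x, g x = (∏ x ∈ Sᶜ, g' x) * ∏ x ∈ S, g x := by
  rw [← Finset.prod_compl_mul_prod S]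
  congr 1
  exact Finset.prod_congr rfl fun x hx => h x (Finset.mem_compl.1 hx)

theorem stateSum_monogon [Finite E] (h : IsStub st r) (pos : ι → Bool) {c : ι} {e : Bool}
    (hin : opp (st false (c, e)) = st true (c, !e)) : 2 * stateSum r st pos =
      ∑ o : ι → Bool, (∏ x ∈ ({c} : Finset ι)ᶜ, splitWeight (pos x) (o x)) *
        eval r loopValue (weightOff st {c}) (Linked st (erased {c} o)) := by
  rw [stateSum, two_mul_sum_eq_sum_update _ c]
  refine Finset.sum_congr rfl fun o _ => ?_
  rw [← sum_monogon h hin (pos c), Finset.mul_sum]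
  refine Finset.sum_congr rfl fun b _ => ?_
  rw [prod_eq_of_eqOn {c} (g' := fun x => splitWeight (pos x) (o x)), Finset.prod_singleton,
    Function.update_self, mul_assoc]
  intro x hx
  rw [Function.update_of_ne (by simpa using hx)]

theorem stateSum_bigon [Finite E] (h : IsStub st r) {pos : ι → Bool} {c d : ι} {b : Bool}
    (hcd : pos d = !pos c) (ho : opp (st false (c, pos c)) = st true (d, pos d))
    (hu : opp (st (!b) (c, !pos c)) = st b (d, !pos d)) : 4 * stateSum r st pos =
      ∑ o : ι → Bool, (∏ x ∈ ({c, d} : Finset ι)ᶜ, splitWeight (pos x) (o x)) *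
        eval r loopValue (weightOff st {c, d}) (Linked st (erased {c, d} o)) := by
  have hne : c ≠ d := by
    rintro rfl
    simp at hcd
  rw [show (4 : BracketRing) = 2 * 2 by norm_num, mul_assoc, stateSum,
    two_mul_sum_eq_sum_update _ d, two_mul_sum_eq_sum_update _ c]
  rw [hcd] at ho
  rw [hcd, Bool.not_not] at hu
  refine Finset.sum_congr rfl fun o _ => ?_
  rw [← sum_bigon h hne ho hu, Finset.mul_sum]
  refine Finset.sum_congr rfl fun k _ => ?_
  rw [Finset.mul_sum]
  refine Finset.sum_congr rfl fun l _ => ?_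
  rw [prod_eq_of_eqOn {c, d} (g' := fun x => splitWeight (pos x) (o x)), Finset.prod_pair hne,
    Function.update_self, Function.update_of_ne hne, Function.update_self, hcd, mul_assoc]
  intro x hx
  simp only [Finset.mem_insert, Finset.mem_singleton, not_or] at hx
  rw [Function.update_of_ne hx.2, Function.update_of_ne hx.1]

theorem stateSum_triangle {pos : ι → Bool} {x y z : ι} {a b c : Bool}
    (h : TriangleMove st x y z (pos x) (pos y) (pos z) a b c) : 8 * stateSum r st pos =
    ∑ o : ι → Bool, (∏ v ∈ ({x, y, z} : Finset ι)ᶜ, splitWeight (pos v) (o v)) *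
      (writheFactor (pos x) * writheFactor (pos y) * writheFactor (pos z) *
      triangleSum r (triangleWeight st {x, y, z} a b (pos x) (pos y) (st a (x, pos x))
        (st b (x, !pos x)) (st c (y, !pos y)) (st (!a) (y, pos y)) (st (!b) (z, pos z))
        (st (!c) (z, !pos z)))
      (LinkedOff st {x, y, z} fun v => some (o v))
      (if pos x == (a == b) then LaurentPolynomial.T 1 else LaurentPolynomial.T (-1))
      (if pos x == (a == b) then LaurentPolynomial.T (-1) else LaurentPolynomial.T 1) loopValue
      (st a (x, pos x)) (st b (x, !pos x)) (st c (y, !pos y)) (st (!a) (y, pos y))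
      (st (!b) (z, pos z)) (st (!c) (z, !pos z)) (st (!a) (x, pos x)) (st (!c) (y, !pos y))
      (st b (z, pos z))) := by
  rw [show (8 : BracketRing) = 2 * (2 * 2) by norm_num, mul_assoc, mul_assoc, stateSum,
    two_mul_sum_eq_sum_update _ z, two_mul_sum_eq_sum_update _ y, two_mul_sum_eq_sum_update _ x]
  refine Finset.sum_congr rfl fun o _ => ?_
  rw [← h.sum_eq, Finset.mul_sum]
  refine Finset.sum_congr rfl fun k _ => ?_
  rw [Finset.mul_sum]
  refine Finset.sum_congr rfl fun l _ => ?_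
  rw [Finset.mul_sum]
  refine Finset.sum_congr rfl fun m _ => ?_
  rw [prod_eq_of_eqOn {x, y, z} (g' := fun x => splitWeight (pos x) (o x)),
    Finset.prod_insert (by simp [h.ne₁₂, h.ne₁₃]), Finset.prod_pair h.ne₂₃,
    Function.update_self, Function.update_of_ne h.ne₂₃, Function.update_self,
    Function.update_of_ne h.ne₁₃, Function.update_of_ne h.ne₁₂, Function.update_self]
  · ring
  · intro v hv
    simp only [Finset.mem_insert, Finset.mem_singleton, not_or] at hv
    rw [Function.update_of_ne hv.2.2, Function.update_of_ne hv.2.1, Function.update_of_ne hv.1]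

/-- The values on `S` are free and give the factor `2 ^ S.card`, which matches the doublings in
`two_mul_sum_eq_sum_update`. -/
theorem sum_comp_embedding {ι' R : Type*} [Fintype ι'] [DecidableEq ι'] [CommRing R]
    (f : ι' ↪ ι) {S : Finset ι} (hf : Set.range f = (S : Set ι)ᶜ) (G : (ι' → Bool) → R) :
    ∑ o : ι → Bool, G (o ∘ f) = 2 ^ S.card * ∑ o, G o := by
  have hbij : Function.Bijective fun o : ι → Bool => ((o ∘ f, fun x => o x) :
      (ι' → Bool) × (S → Bool)) := by
    constructor
    · intro o o' h
      funext x
      by_cases hx : x ∈ S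
      · exact congrFun (congrArg Prod.snd h) ⟨x, hx⟩
      · obtain ⟨y, rfl⟩ : x ∈ Set.range f := by
          rw [hf]
          exact hx
        exact congrFun (congrArg Prod.fst h) y
    · rintro ⟨o, t⟩
      refine ⟨fun x => if hx : x ∈ S then t ⟨x, hx⟩ else Function.extend f o (fun _ => true) x,
        Prod.ext (funext fun y => ?_) (funext fun x => dif_pos x.2)⟩
      have : f y ∉ S := by
        have : f y ∈ Set.range f := ⟨y, rfl⟩
        rw [hf] at this
        exact this
      simp [this, f.injective.extend_apply]
  rw [Fintype.sum_equiv (Equiv.ofBijective _ hbij) (fun o => G (o ∘ f)) (fun q => G q.1)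
    fun _ => rfl, Fintype.sum_prod_type_right]
  simp

end Wiring

/-! ### Comparing state sums along maps of edges. -/

namespace KnotoidDiagram

variable {D D' : KnotoidDiagram}

theorem stateSum_eq (D : KnotoidDiagram) :
    D.stateSum = Wiring.stateSum none D.stub D.positive := rfl

theorem isStub (D : KnotoidDiagram) : IsStub D.stub (none : D.Edge) where
  inj h := D.stub_inj.1 h
  ne_root b p := by cases b <;> simp [ArcCode.stub]

theorem exists_isFlow (D : KnotoidDiagram) (o : Fin D.n → Bool) :
    ∃ W, IsFlow (D.Linked fun c => some (o c)) none W := by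
  let s : D.State := State.orientation (D := D) o
  have h := s.isFlow
  rw [show s.orientation = o from State.orientation_involutive o] at h
  exact ⟨_, h⟩

/-- A diagram may be evaluated on another set of edges which retracts to its own one. -/
theorem eval_eq_of_retract {E : Type} {r : E} {ι : Type} [Fintype ι]
    {st : Bool → ι × Bool → E × Bool} {κ : ι → Option Bool} (U : (E × Bool → ℤ) → BracketRing)
    (f : Fin D'.n → ι) (χ : E → D'.Edge) (φ : D'.Edge → E) (hχr : χ r = none)
    (hst : ∀ b c e, D'.stub b (c, e) = (χ (st b (f c, e)).1, (st b (f c, e)).2))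
    {o : Fin D'.n → Bool} (hκ : ∀ c, κ (f c) = some (o c)) (hκ' : ∀ x, κ x ≠ none → x ∈ Set.range f)
    (hthrough : ∀ x, κ x = none → ∀ e,
      (χ (st true (x, e)).1, (st true (x, e)).2) = opp (χ (st false (x, e)).1, (st false (x, e)).2))
    (hφχ : ∀ q, Comp.mk (Linked st κ) (φ (χ q)) = Comp.mk (Linked st κ) q)
    (hχφ : ∀ q, χ (φ q) = q)
    (hU : ∀ W, IsFlow (Linked st κ) r W → U W = uPow (-∑ c, crossingFlow st W (f c))) :
    eval r loopValue U (Linked st κ) =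
      eval none loopValue (weight D'.stub)
        (D'.Linked fun c => some (o c)) := by
  obtain ⟨W', hW'⟩ := D'.exists_isFlow o
  have mapPairs : ∀ k c, pairs D'.stub k c = (pairs st k (f c)).map
      (Prod.map (fun d => (χ d.1, d.2)) fun d => (χ d.1, d.2)) := by
    intro k c
    rcases k with _ | _ | _ <;> simp [pairs, hst]
  refine eval_retract loopValue U _ χ φ hχr ?_ ?_ hφχ hχφ hW' ?_
  · rintro d d' ⟨x, hx⟩
    rcases hκx : κ x with _ | k
    · rw [hκx] at hx
      simp only [pairs, List.mem_cons, Prod.mk.injEq, List.not_mem_nil, or_false] at hx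
      rcases hx with ⟨rfl, rfl⟩ | ⟨rfl, rfl⟩ <;> exact .inr (.inr (hthrough x hκx _))
    · obtain ⟨c, rfl⟩ := hκ' x (by simp [hκx])
      refine .inl ⟨c, ?_⟩
      rw [hκ] at hx
      rw [mapPairs]
      exact List.mem_map.2 ⟨_, hx, rfl⟩
  · rintro d d' ⟨c, hc⟩
    rw [mapPairs] at hc
    obtain ⟨⟨x, x'⟩, hx, hxd⟩ := List.mem_map.1 hc
    obtain ⟨rfl, rfl⟩ := Prod.mk.inj hxd
    rw [hφχ, hφχ]
    exact Comp.sound ⟨f c, by rwa [hκ]⟩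
  · intro W hW hWχ
    rw [hU W hW, weight]
    simp only [crossingFlow, hWχ, hst]

end KnotoidDiagram

theorem two_ne_zero_bracketRing : (2 : BracketRing) ≠ 0 := by
  rw [← map_ofNat (LaurentPolynomial.C : LaurentPolynomial ℤ →+* BracketRing) 2,
    ← map_ofNat (LaurentPolynomial.C : ℤ →+* LaurentPolynomial ℤ) 2]
  intro h
  have := congrArg (fun b : BracketRing => (b.coeff 0).coeff 0) h
  simp [LaurentPolynomial.C_apply] at this

/-! ### Invariance -/

namespace KnotoidDiagram

variable {D D' : KnotoidDiagram}

theorem opp_stub_of_next {p p' : Fin D.n × Bool} (h : D.next (some p) = some p') :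
    opp (D.stub false p) = D.stub true p' := by
  simp [ArcCode.stub, opp, ← h]

theorem Consecutive.opp_stub {a : Bool} {p p' : Fin D.n × Bool} (h : D.Consecutive a p p') :
    opp (D.stub (!a) p) = D.stub a p' := by
  cases a
  · have h : D.next (some p') = some p := by simpa [Consecutive] using h
    exact (by rw [← opp_stub_of_next h, opp_opp] : opp (D.stub true p) = D.stub false p')
  · exact opp_stub_of_next (by simpa [Consecutive] using h)

/-- The state sum of a diagram whose curve is identified with that of another one, where the
passage `p` is at the place of the passage `τ p`. -/
theorem stateSum_transport (f : Fin D.n ≃ Fin D'.n) (χ : D.Edge ≃ D'.Edge)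
    (τ : Fin D.n × Bool → Fin D.n × Bool) (hpos : ∀ v, D'.positive (f v) = D.positive v)
    (h₀ : χ none = none) (hτ : ∀ p, χ (some (τ p)) = some (Prod.map f id p))
    (hnext : ∀ q, D'.next (χ q) = χ (D.next q)) :
    D'.stateSum = Wiring.stateSum none (fun b p => D.stub b (τ p)) D.positive := by
  symm
  rw [stateSum_eq, Wiring.stateSum, Wiring.stateSum]
  refine Fintype.sum_equiv (f.arrowCongr (Equiv.refl Bool)) _ _ fun o => ?_
  have hp : ∏ c, splitWeight (D.positive c) (o c) = ∏ c', splitWeight (D'.positive c')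
      (f.arrowCongr (Equiv.refl Bool) o c') := by
    rw [← Equiv.prod_comp f]
    refine Finset.prod_congr rfl fun c _ => ?_
    rw [hpos]
    simp
  rw [hp]
  refine congrArg _ ?_
  refine eval_eq_of_retract _ f.symm χ χ.symm h₀ ?_ (fun c => rfl)
    (fun x _ => f.symm.surjective x) (fun x hx => by simp at hx)
    (fun q => by rw [Equiv.symm_apply_apply]) (fun q => by rw [Equiv.apply_symm_apply]) ?_
  · intro b c e
    have h1 : χ (some (τ (f.symm c, e))) = some (c, e) := by
      rw [hτ]
      simp
    cases b
    · simp only [D.stub_false, D'.stub_false, h1]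
    · simp only [D.stub_true, D'.stub_true]
      have h2 : D'.next.symm (some (c, e)) = χ (D.next.symm (some (τ (f.symm c, e)))) := by
        rw [Equiv.symm_apply_eq, hnext, Equiv.apply_symm_apply, h1]
      rw [h2]
  · intro W _
    rw [weight, Equiv.sum_comp f.symm (crossingFlow _ W)]

theorem Relabel.stateSum_eq (h : D.Relabel D') : D.stateSum = D'.stateSum := by
  obtain ⟨f, hpos, hnext⟩ := h
  exact (stateSum_transport f (Equiv.optionCongr (f.prodCongr (Equiv.refl Bool))) id hpos rfl
    (fun p => rfl) hnext).symm

/-- Erasing crossings merges edges; `χ` sends an edge to the merged edge containing it. -/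
theorem exists_retraction {f : Fin D'.n ↪ Fin D.n} {S : Set (Fin D.n)} (hf : Set.range f = Sᶜ)
    (hchain : ∀ q, ∃ m : ℕ,
      D.next^[m + 1] (Option.map (Prod.map f id) q) = Option.map (Prod.map f id) (D'.next q) ∧
      ∀ j < m, ∃ c ∈ S, ∃ e, D.next^[j + 1] (Option.map (Prod.map f id) q) = some (c, e)) :
    ∃ χ : D.Edge → D'.Edge, (∀ q, χ (Option.map (Prod.map f id) q) = q) ∧
      (∀ p : Fin D.n × Bool, p.1 ∈ S → χ (some p) = χ (D.next.symm (some p))) ∧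
      ∀ q, χ (D.next.symm (Option.map (Prod.map f id) q)) = D'.next.symm q := by
  classical
  set φ : D'.Edge → D.Edge := Option.map (Prod.map f id) with hφ
  have hφinj : Function.Injective φ :=
    Option.map_injective (f.injective.prodMap Function.injective_id)
  have hφS : ∀ p : Fin D.n × Bool, p.1 ∈ S → ∀ q, φ q ≠ some p := by
    rintro ⟨c, e⟩ hc (_ | ⟨c', e'⟩) h
    · simp [hφ] at h
    · simp only [hφ, Option.map_some, Prod.map_apply, Option.some_inj, Prod.mk.injEq] at h
      have : f c' ∈ Set.range f := ⟨c', rfl⟩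
      rw [hf, h.1] at this
      exact this hc
  -- A walk from the leg that remembers the last edge starting at the leg or after a surviving
  -- passage; an erased passage leaves the remembered edge unchanged.
  let g : ℕ → D'.Edge := fun m => Nat.rec none
    (fun m x => if h : ∃ q, φ q = D.next^[m + 1] none then h.choose else x) m
  have g_succ : ∀ m, g (m + 1) =
      if h : ∃ q, φ q = D.next^[m + 1] none then h.choose else g m := fun m => rfl
  let idx : D.Edge → ℕ := fun q => Nat.find (D.isArc q)
  have idx_spec : ∀ q, D.next^[idx q] none = q := fun q => Nat.find_spec (D.isArc q)
  have idx_le : ∀ {q m}, D.next^[m] none = q → idx q ≤ m := fun h => Nat.find_min' _ h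
  have h1 : ∀ q, g (idx (φ q)) = q := by
    intro q
    have hq := idx_spec (φ q)
    rcases hm : idx (φ q) with _ | m
    · rw [hm] at hq
      exact hφinj hq
    · rw [hm] at hq
      have hex : ∃ q', φ q' = D.next^[m + 1] none := ⟨q, hq.symm⟩
      rw [g_succ, dif_pos hex]
      exact hφinj (hex.choose_spec.trans hq)
  have h2 : ∀ p : Fin D.n × Bool, p.1 ∈ S → g (idx (some p)) = g (idx (D.next.symm (some p))) := by
    intro p hp
    have hq := idx_spec (some p)
    rcases hm : idx (some p) with _ | m
    · rw [hm] at hq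
      simp at hq
    · rw [hm] at hq
      have hex : ¬∃ q', φ q' = D.next^[m + 1] none := fun ⟨q', hq'⟩ => hφS p hp q' (hq'.trans hq)
      rw [g_succ, dif_neg hex]
      congr 1
      refine le_antisymm ?_ (idx_le ?_)
      · have h3 : idx (some p) ≤ idx (D.next.symm (some p)) + 1 := idx_le (by
          rw [Function.iterate_succ_apply', idx_spec, Equiv.apply_symm_apply])
        omega
      · rw [Function.iterate_succ_apply'] at hq
        rw [← hq, Equiv.symm_apply_apply]
  refine ⟨fun q => g (idx q), h1, h2, fun q => ?_⟩
  obtain ⟨m, hm, hS⟩ := hchain (D'.next.symm q)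
  rw [Equiv.apply_symm_apply] at hm
  -- Between two surviving passages only erased ones occur, so the remembered edge is constant
  -- there.
  have key : ∀ j ≤ m, g (idx (D.next^[j] (φ (D'.next.symm q)))) = D'.next.symm q := by
    intro j
    induction j with
    | zero => exact fun _ => h1 _
    | succ j ih =>
      intro hj
      obtain ⟨c, hc, e, hce⟩ := hS j (by omega)
      rw [hce, h2 (c, e) hc, ← hce, Function.iterate_succ_apply', Equiv.symm_apply_apply]
      exact ih (by omega)
  rw [← key m le_rfl, ← hm, Function.iterate_succ_apply', Equiv.symm_apply_apply]

/-- Under the retraction the two pairs at an erased crossing become pairs of opposite ends, which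
affect neither components nor flows. -/
theorem Erase.sum_eq {S : Finset (Fin D.n)} (h : D.Erase S D') :
    ∑ o : Fin D.n → Bool, (∏ x ∈ Sᶜ, splitWeight (D.positive x) (o x)) *
      eval none loopValue (weightOff D.stub S) (Linked D.stub (erased S o)) =
    2 ^ S.card * D'.stateSum := by
  obtain ⟨f, hf, hpos, hchain⟩ := h
  obtain ⟨χ, h1, h2, h3⟩ := exists_retraction hf hchain
  have hSc : Sᶜ = Finset.univ.map f := by
    ext x
    have : x ∈ Set.range f ↔ x ∉ S := by rw [hf]; rfl
    simpa using this.symm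
  have hfS : ∀ c, f c ∉ S := by
    intro c
    have : f c ∈ Set.range f := ⟨c, rfl⟩
    rw [hf] at this
    exact this
  rw [stateSum_eq, Wiring.stateSum, ← sum_comp_embedding f hf]
  refine Finset.sum_congr rfl fun o _ => ?_
  have hstub : ∀ b c e,
      D'.stub b (c, e) = (χ (D.stub b (f c, e)).1, (D.stub b (f c, e)).2) := by
    intro b c e
    cases b
    · exact congrArg (·, true) (h1 (some (c, e))).symm
    · exact congrArg (·, false) (h3 (some (c, e))).symm
  rw [hSc, Finset.prod_map]
  refine congrArg₂ (· * ·) (Finset.prod_congr rfl fun c _ => by rw [hpos]; rfl) ?_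
  refine eval_eq_of_retract _ f χ (Option.map (Prod.map f id)) (h1 none) hstub
    (fun c => if_neg (hfS c)) ?_ ?_ ?_ h1 ?_
  · intro x hx
    rw [hf]
    exact fun hxS => hx (if_pos hxS)
  · intro x hx e
    have hxS : x ∈ S := by
      by_contra hxS
      rw [erased, if_neg hxS] at hx
      simp at hx
    simp only [D.stub_true, D.stub_false, h2 (x, e) hxS]
    rfl
  · refine D.isArc.induction (by rw [show χ none = none from h1 none]; rfl) ?_
    rintro ⟨c, e⟩ ih
    by_cases hc : c ∈ S
    · rw [h2 (c, e) hc, ih]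
      refine Comp.sound (d := D.stub true (c, e)) (d' := D.stub false (c, e)) ⟨c, ?_⟩
      rw [erased, if_pos hc]
      cases e <;> simp [pairs]
    · obtain ⟨c', rfl⟩ : c ∈ Set.range f := by
        rw [hf]
        exact hc
      have : χ (some (f c', e)) = some (c', e) := h1 (some (c', e))
      rw [this]
      rfl
  · intro W _
    rw [weightOff, hSc, Finset.sum_map]

theorem ReidemeisterI.stateSum_eq (h : D.ReidemeisterI D') : D.stateSum = D'.stateSum := by
  obtain ⟨c, e, hce, herase⟩ := h
  rw [← Finset.coe_singleton] at herase
  have := stateSum_monogon D.isStub D.positive (opp_stub_of_next hce)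
  rw [herase.sum_eq, Finset.card_singleton, pow_one] at this
  exact mul_left_cancel₀ two_ne_zero_bracketRing this

theorem ReidemeisterII.stateSum_eq (h : D.ReidemeisterII D') : D.stateSum = D'.stateSum := by
  obtain ⟨c, d, hne, hov, hun, herase⟩ := h
  have hcd : c ≠ d := fun h => hne (congrArg _ h)
  have hd : D.positive d = !D.positive c := by
    revert hne
    cases D.positive c <;> cases D.positive d <;> simp
  rw [← Finset.coe_pair] at herase
  have key : 4 * D.stateSum = 4 * D'.stateSum := by
    rw [show (4 : BracketRing) = 2 ^ ({c, d} : Finset (Fin D.n)).card by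
      rw [Finset.card_pair hcd]; norm_num, ← herase.sum_eq, Finset.card_pair hcd,
      show (2 : BracketRing) ^ 2 = 4 by norm_num]
    rcases hun with hun | hun
    · exact stateSum_bigon D.isStub (b := true) hd (opp_stub_of_next hov) (opp_stub_of_next hun)
    · refine stateSum_bigon D.isStub (b := false) hd (opp_stub_of_next hov) ?_
      have := opp_stub_of_next hun
      rw [Bool.not_false, ← opp_opp (D.stub false _)]
      exact congrArg opp this.symm
  refine mul_left_cancel₀ ?_ key
  rw [show (4 : BracketRing) = 2 ^ 2 by norm_num]
  exact pow_ne_zero 2 two_ne_zero_bracketRing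

end KnotoidDiagram

/-! ### Invariance under the third Reidemeister move. -/

namespace Wiring

theorem swap_mul_swap_mul_swap {α : Type*} [DecidableEq α] {p₁ p₂ p₃ p₄ p₅ p₆ : α}
    (h : [p₁, p₂, p₃, p₄, p₅, p₆].Nodup) :
    let τ := Equiv.swap p₁ p₂ * Equiv.swap p₃ p₄ * Equiv.swap p₅ p₆
    τ p₁ = p₂ ∧ τ p₂ = p₁ ∧ τ p₃ = p₄ ∧ τ p₄ = p₃ ∧ τ p₅ = p₆ ∧ τ p₆ = p₅ ∧
      ∀ p ∉ [p₁, p₂, p₃, p₄, p₅, p₆], τ p = p := by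
  simp only [List.nodup_cons, List.mem_cons, List.not_mem_nil, or_false, not_or,
    List.nodup_nil, and_true, not_false_eq_true] at h
  obtain ⟨⟨h12, h13, h14, h15, h16⟩, ⟨h23, h24, h25, h26⟩, ⟨h34, h35, h36⟩, ⟨h45, h46⟩, h56⟩ := h
  simp only [Equiv.Perm.mul_apply, Equiv.swap_apply_def]
  refine ⟨?_, ?_, ?_, ?_, ?_, ?_, fun p hp => ?_⟩
  · simp [h13, h14, h15, h16]
  · simp [h23, h24, h25, h26]
  · simp [h35, h36, Ne.symm h14, Ne.symm h24]
  · simp [h45, h46, Ne.symm h34, Ne.symm h13, Ne.symm h23]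
  · simp [Ne.symm h16, Ne.symm h26, Ne.symm h36, Ne.symm h46]
  · simp [Ne.symm h56, Ne.symm h15, Ne.symm h25, Ne.symm h35, Ne.symm h45]
  · simp only [List.mem_cons, List.not_mem_nil, or_false, not_or] at hp
    simp [hp]

variable {ι E : Type} {st st' : Bool → ι × Bool → E × Bool} {r : E} [Fintype ι] [DecidableEq ι]
  {pos : ι → Bool} {x y z : ι} {a b c : Bool}

/-- The state sum is preserved if a triangle is passed over by the opposite strands. -/
theorem TriangleMove.stateSum_eq [Finite E]
    (h : TriangleMove st x y z (pos x) (pos y) (pos z) a b c) (hs : IsStub st r)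
    (hx : ∀ i, st' i (x, pos x) = st i (y, pos y)) (hx' : ∀ i, st' i (x, !pos x) = st i (z, pos z))
    (hy : ∀ i, st' i (y, pos y) = st i (x, pos x))
    (hy' : ∀ i, st' i (y, !pos y) = st i (z, !pos z))
    (hz : ∀ i, st' i (z, pos z) = st i (x, !pos x))
    (hz' : ∀ i, st' i (z, !pos z) = st i (y, !pos y))
    (hoff : ∀ v ∉ ({x, y, z} : Finset ι), ∀ i e, st' i (v, e) = st i (v, e)) :
    stateSum r st' pos = stateSum r st pos := by
  -- The new wiring is again a triangle with the same corners and signs, now with all three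
  -- directions reversed.
  have h' : TriangleMove st' x y z (pos x) (pos y) (pos z) (!a) (!b) (!c) := by
    refine ⟨h.ne₁₂, h.ne₁₃, h.ne₂₃, ?_, ?_, ?_, ?_, ?_⟩
    · rw [hx, hy, Bool.not_not, ← h.top, opp_opp]
    · rw [hz, hx', Bool.not_not, ← h.mid, opp_opp]
    · rw [hy', hz', Bool.not_not, ← h.bot, opp_opp]
    · rw [h.sign₁₂]
      cases b <;> cases c <;> simp
    · rw [h.sign₁₃]
      cases a <;> cases c <;> simp
  have h8 : (8 : BracketRing) ≠ 0 := by
    rw [show (8 : BracketRing) = 2 ^ 3 by norm_num]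
    exact pow_ne_zero 3 two_ne_zero_bracketRing
  refine mul_left_cancel₀ h8 ?_
  rw [stateSum_triangle h, stateSum_triangle h']
  refine Finset.sum_congr rfl fun o _ => ?_
  have hP : LinkedOff st' {x, y, z} (fun v => some (o v)) =
      LinkedOff st {x, y, z} fun v => some (o v) := by
    funext d d'
    refine propext (exists_congr fun v => and_congr_right fun hv => ?_)
    cases o v <;> simp only [pairs, hoff v hv]
  have hU : triangleWeight st' {x, y, z} (!a) (!b) (pos x) (pos y) (st (!a) (y, pos y))
      (st (!b) (z, pos z)) (st (!c) (z, !pos z)) (st a (x, pos x)) (st b (x, !pos x))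
      (st c (y, !pos y)) = triangleWeight st {x, y, z} a b (pos x) (pos y) (st a (x, pos x))
      (st b (x, !pos x)) (st c (y, !pos y)) (st (!a) (y, pos y)) (st (!b) (z, pos z))
      (st (!c) (z, !pos z)) := by
    funext W
    rw [triangleWeight, triangleWeight, triangleFlow_not, weightOff, weightOff]
    refine congrArg (fun t => uPow (-t) * _) (Finset.sum_congr rfl fun v hv => ?_)
    simp only [crossingFlow, hoff v (Finset.mem_compl.1 hv)]
  have hu : st a (y, pos y) = opp (st (!a) (x, pos x)) := h.top.symm
  have hv : st c (z, !pos z) = opp (st (!c) (y, !pos y)) := h.bot.symm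
  have hw : st (!b) (x, !pos x) = opp (st b (z, pos z)) := h.mid.symm
  simp only [hx, hx', hy, hy', hz, hz', Bool.not_not, hP, hU]
  rw [hu, hv, hw]
  have hab : ((!a) == (!b)) = (a == b) := by cases a <;> cases b <;> rfl
  rw [hab]
  -- The outer ends of the new triangle are the old ones turned by a half turn and its sides are the
  -- old ones reversed, so the two sums are related by `triangleSum_reflect`.
  refine congrArg _ (congrArg _ (triangleSum_reflect (h.isTriangle hs _) ?_ ?_ loopValue_ne_zero))
  · split_ifs <;> rw [← LaurentPolynomial.T_add] <;> rfl
  · rw [loopValue]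
    split_ifs <;> simp only [LaurentPolynomial.T_pow] <;> norm_num
    ring

end Wiring

namespace KnotoidDiagram

variable {D D' : KnotoidDiagram}

theorem ReidemeisterIII.stateSum_eq (h : D.ReidemeisterIII D') : D.stateSum = D'.stateSum := by
  obtain ⟨x, y, z, hxy, hxz, hyz, a, b, c, hT, hM, hB, s₁, s₂, f, hpos, σ, hσ, hnext⟩ := h
  have htri : TriangleMove D.stub x y z (D.positive x) (D.positive y) (D.positive z) a b c := by
    refine ⟨hxy, hxz, hyz, hT.opp_stub, ?_, hB.opp_stub, s₁, s₂⟩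
    have := hM.opp_stub
    exact (congrArg opp this.symm).trans (opp_opp _)
  have nyx := hxy.symm
  have nzy := hyz.symm
  have hnodup : [(x, D.positive x), (y, D.positive y), (x, !D.positive x), (z, D.positive z),
      (y, !D.positive y), (z, !D.positive z)].Nodup := by
    simp [hxy, hxz, hyz, nyx, nzy]
  obtain ⟨t₁, t₂, t₃, t₄, t₅, t₆, t⟩ := swap_mul_swap_mul_swap hnodup
  obtain ⟨r₁, r₂, r₃, r₄, r₅, r₆, r⟩ := swap_mul_swap_mul_swap
    (hnodup.map (Option.some_injective _))
  set τ := Equiv.swap (x, D.positive x) (y, D.positive y) *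
    Equiv.swap (x, !D.positive x) (z, D.positive z) *
    Equiv.swap (y, !D.positive y) (z, !D.positive z)
  simp only [overpass, underpass] at hσ
  rw [← hσ] at r₁ r₂ r₃ r₄ r₅ r₆ r
  -- `τ` is `σ` on passages and an involution, since the six passages are different. So the passage
  -- `p` of the new diagram sits at the old place `τ p`.
  have hτ : ∀ p, σ (some (τ p)) = some p := by
    intro p
    by_cases hp : p ∈ [(x, D.positive x), (y, D.positive y), (x, !D.positive x),
      (z, D.positive z), (y, !D.positive y), (z, !D.positive z)]
    · simp only [List.mem_cons, List.not_mem_nil, or_false] at hp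
      rcases hp with rfl | rfl | rfl | rfl | rfl | rfl
      · rw [t₁, r₂]
      · rw [t₂, r₁]
      · rw [t₃, r₄]
      · rw [t₄, r₃]
      · rw [t₅, r₆]
      · rw [t₆, r₅]
    · rw [t p hp]
      exact r _ fun h => hp ((List.mem_map_of_injective (Option.some_injective _)).1 h)
  have h₀ : σ none = none := r none (by simp)
  rw [stateSum_transport f (σ.trans (Equiv.optionCongr (f.prodCongr (Equiv.refl Bool)))) τ hpos
    (by rw [Equiv.trans_apply, h₀]; rfl) (fun p => by rw [Equiv.trans_apply, hτ]; rfl) hnext,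
    D.stateSum_eq]
  refine (htri.stateSum_eq (st' := fun i p => D.stub i (τ p)) D.isStub (fun i => congrArg _ t₁) (fun i => congrArg _ t₃)
    (fun i => congrArg _ t₂) (fun i => congrArg _ t₅) (fun i => congrArg _ t₄) (fun i => congrArg _ t₆)
    fun v hv i e => ?_).symm
  simp only [Finset.mem_insert, Finset.mem_singleton, not_or] at hv
  exact congrArg _ (t _ (by simp [hv]))

theorem Move.stateSum_eq (h : D.Move D') : D.stateSum = D'.stateSum := by
  rcases h with h | h | h | h
  · exact h.stateSum_eq
  · exact h.stateSum_eq
  · exact h.stateSum_eq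
  · exact h.stateSum_eq

theorem Isotopic.extendedBracket_eq (h : D.Isotopic D') :
    D.extendedBracket = D'.extendedBracket := by
  induction h with
  | rel _ _ h => exact extendedBracket_congr h.stateSum_eq
  | refl _ => rfl
  | symm _ _ _ ih => exact ih.symm
  | trans _ _ _ _ _ ih ih' => exact ih.trans ih'

end KnotoidDiagram

theorem mainTheorem9 :
    (∀ (D : KnotoidDiagram) (α : D.Shortcut), D.extendedBracketAlong α = D.extendedBracket) ∧
    (∀ D : KnotoidDiagram, ∃ n₁ m₁ : ℕ, ∀ k : ℕ,
      PowerSeries.coeff k D.extendedBracketSeries =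
        ∑ l ∈ Finset.Icc (-(n₁ : ℤ)) (m₁ : ℤ),
          LaurentPolynomial.C (D.bracketCoeff k l) * LaurentPolynomial.T l) ∧
    ∀ k : ℕ,
      IsTypeInvariant k
        (fun D : KnotoidDiagram => PowerSeries.coeff k D.extendedBracketSeries) ∧
      ∀ l : ℤ, IsTypeInvariant k (fun D : KnotoidDiagram => D.bracketCoeff k l) := by
  refine ⟨fun D α => D.extendedBracketAlong_eq α, fun D => D.exists_expansion, fun k =>
    ⟨⟨fun D D' h => ?_, fun S hk => S.coeff_extend_eq_zero hk⟩, fun l =>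
      ⟨fun D D' h => ?_, fun S hk => S.bracketCoeff_extend_eq_zero hk l⟩⟩⟩
  · simp only [KnotoidDiagram.extendedBracketSeries, h.extendedBracket_eq]
  · simp only [KnotoidDiagram.bracketCoeff, KnotoidDiagram.extendedBracketSeries,
      h.extendedBracket_eq]
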